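/- Let $A=(a_{ij})_{1\le i,j\le r}$ be a generalized Cartan matrix, with realization $(\mathfrak h,\{\alpha_i\},\{h_i\})$ over $\mathbb C$: $\dim\mathfrak h=2r-\operatorname{rank}A$, the simple roots $\alpha_i\in\mathfrak h^*$ and the simple coroots $h_i\in\mathfrak h$ are linearly independent families, and $\alpha_j(h_i)=a_{ij}$. Let $\mathfrak h_{\mathbb Z}\subset\mathfrak h$ be a lattice with $\mathfrak h_{\mathbb Z}\otimes_{\mathbb Z}\mathbb C=\mathfrak h$, $h_i\in\mathfrak h_{\mathbb Z}$, $\alpha_i\in\mathfrak h_{\mathbb Z}^*=\mathrm{Hom}(\mathfrak h_{\mathbb Z},\mathbb Z)\subset\mathfrak h^*$ and $\mathfrak h_{\mathbb Z}/\sum_i\mathbb Zh_i$ torsion-free. Let $\rho_i\in\mathfrak h_{\mathbb Z}^*$ be fundamental weights, $\rho_i(h_j)=\delta_{ij}$, and put $\rho=\sum_i\rho_i$. Let $W\subset\mathrm{Aut}(\mathfrak h^*)$ be the Weyl group, generated by the simple reflections $s_i(\lambda)=\lambda-\lambda(h_i)\alpha_i$, with length $\ell$ and Bruhat order $\le$.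 Let $R[T]=\mathbb Z[\mathfrak h_{\mathbb Z}^*]$ be the representation ring of the torus $T$, with characters $e^\lambda$ ($\lambda\in\mathfrak h_{\mathbb Z}^*$), and let $Q[T]$ be its fraction field. For $f:W\to Q[T]$ and $1\le i\le r$ put $$(D_if)(v)=\frac{f(v)-f(vs_i)e^{-v\alpha_i}}{1-e^{-v\alpha_i}},$$ and $D_w=D_{i_1}\cdots D_{i_l}$ for any reduced decomposition $w=s_{i_1}\cdots s_{i_l}$. Let $\Psi$ be the set of functions $f:W\to R[T]$ such that $D_wf$ takes values in $R[T]$ for every $w\in W$. Let $\underline W$ be the monoid generated by $\underline s_1,\dots,\underline s_r$ subject to $\underline s_i^2=\underline s_i$ and to the braid relations of $W$; for $w\in W$ let $\underline w=\underline s_{i_1}\cdots\underline s_{i_l}$, where $w=s_{i_1}\cdots s_{i_l}$ is any reduced decomposition. There is a unique family $(\psi^w)_{w\in W}$ of elements of $\Psi$ such that $D_u(\psi^w)(1)=\delta_{u,w}$ for all $u,w\in W$ (the Kostant–Kumar functions). Moreover, let $w,v\in W$ with $w\le v$, let $v=s_{i_1}\cdots s_{i_l}$ be any decomposition of $v$,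 not necessarily reduced, and put $\beta_j=s_{i_1}\cdots s_{i_{j-1}}\alpha_{i_j}$ for $1\le j\le l$. Then $$\psi^w(v)=e^{\rho-v\rho}\sum_{\ell(w)\le m\le l}\ \sum_{\substack{1\le j_1<\cdots<j_m\le l\\ \underline s_{i_{j_1}}\cdots\,\underline s_{i_{j_m}}=\underline w}}(e^{-\beta_{j_1}}-1)\cdots(e^{-\beta_{j_m}}-1).$$ -/

import Mathlib

open Module

/-- Generalized Cartan matrices. -/
structure IsGCM {r : ℕ} (A : Matrix (Fin r) (Fin r) ℤ) : Prop where
  diag : ∀ i, A i i = 2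
  offDiag : ∀ i j, i ≠ j → A i j ≤ 0
  zero_iff : ∀ i j, A i j = 0 ↔ A j i = 0

/-- The combinatorial data attached to a generalized Cartan matrix `A`: a realization
`(𝔥, {α i}, {h i})` over `ℂ`, a lattice `𝔥_ℤ` in `𝔥` (the `ℤ`-span of a `ℂ`-basis of `𝔥`) which
contains the `h i`, on which the `α i` are integral and such that `𝔥_ℤ / ∑ ℤ h i` is torsion-free,
and a choice of fundamental weights. -/
structure KacMoodyDatum {r : ℕ} (A : Matrix (Fin r) (Fin r) ℤ)
    (𝔥 : Type*) [AddCommGroup 𝔥] [Module ℂ 𝔥] where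
  isGCM : IsGCM A
  /-- `dim 𝔥 = 2 r - rank A` -/
  finrank_add_rank : finrank ℂ 𝔥 + (A.map (Int.cast : ℤ → ℂ)).rank = 2 * r
  /-- simple roots -/
  α : Fin r → Dual ℂ 𝔥
  /-- simple coroots -/
  h : Fin r → 𝔥
  α_linearIndependent : LinearIndependent ℂ α
  h_linearIndependent : LinearIndependent ℂ h
  pairing : ∀ i j, α j (h i) = (A i j : ℂ)
  /-- the lattice `𝔥_ℤ` -/
  lattice : Submodule ℤ 𝔥
  lattice_basis : ∃ (n : ℕ) (b : Basis (Fin n) ℂ 𝔥), lattice = Submodule.span ℤ (Set.range b)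
  h_mem : ∀ i, h i ∈ lattice
  torsionFree : ∀ x ∈ lattice, ∀ n : ℤ, n ≠ 0 →
    n • x ∈ Submodule.span ℤ (Set.range h) → x ∈ Submodule.span ℤ (Set.range h)
  α_integral : ∀ i, ∀ x ∈ lattice, ∃ n : ℤ, α i x = n
  /-- fundamental weights -/
  fund : Fin r → Dual ℂ 𝔥
  fund_integral : ∀ i, ∀ x ∈ lattice, ∃ n : ℤ, fund i x = n
  fund_apply : ∀ i j, fund i (h j) = if i = j then 1 else 0

namespace KacMoodyDatum

noncomputable section

variable {r : ℕ} {A : Matrix (Fin r) (Fin r) ℤ} {𝔥 : Type*} [AddCommGroup 𝔥] [Module ℂ 𝔥]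
  (D : KacMoodyDatum A 𝔥)

/-! ### Weyl group, length, Bruhat order -/

theorem α_h_self (i : Fin r) : Dual.eval ℂ 𝔥 (D.h i) (D.α i) = 2 := by
  simp [D.pairing, D.isGCM.diag]

/-- The reflection `μ ↦ μ - μ(h i) α i` of `𝔥*`. -/
def refl (i : Fin r) : Dual ℂ 𝔥 ≃ₗ[ℂ] Dual ℂ 𝔥 := Module.reflection (D.α_h_self i)

theorem refl_apply (i : Fin r) (μ : Dual ℂ 𝔥) : D.refl i μ = μ - μ (D.h i) • D.α i := by
  simp [refl, Module.reflection_apply]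

/-- The Weyl group `W ⊂ Aut(𝔥*)`. -/
abbrev W : Subgroup (Dual ℂ 𝔥 ≃ₗ[ℂ] Dual ℂ 𝔥) := Subgroup.closure (Set.range D.refl)

/-- The simple reflections, as elements of `W`. -/
def s (i : Fin r) : D.W := ⟨D.refl i, Subgroup.subset_closure ⟨i, rfl⟩⟩

/-- The product `s_{i₁} ⋯ s_{iₗ}` in `W` of a word `[i₁, …, iₗ]`. -/
def wordProd (ω : List (Fin r)) : D.W := (ω.map D.s).prod

/-- Every element of `W` is a product of simple reflections. -/
theorem exists_wordProd (w : D.W) : ∃ ω, D.wordProd ω = w := by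
  have hs : ∀ i, (D.s i)⁻¹ = D.s i := by
    intro i
    apply Subtype.ext
    change (D.refl i)⁻¹ = D.refl i
    rw [inv_eq_iff_mul_eq_one]
    ext1 μ
    exact Module.involutive_reflection (D.α_h_self i) μ
  obtain ⟨g, hg⟩ := w
  induction hg using Subgroup.closure_induction with
  | mem x hx =>
    obtain ⟨i, rfl⟩ := hx
    exact ⟨[i], by simp [wordProd, s]⟩
  | one => exact ⟨[], rfl⟩
  | mul x y hx hy h1 h2 =>
    obtain ⟨a, ha⟩ := h1
    obtain ⟨b, hb⟩ := h2
    refine ⟨a ++ b, ?_⟩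
    have : D.wordProd (a ++ b) = D.wordProd a * D.wordProd b := by simp [wordProd]
    rw [this, ha, hb]
    rfl
  | inv x hx h1 =>
    obtain ⟨a, ha⟩ := h1
    refine ⟨a.reverse, ?_⟩
    have : D.wordProd a.reverse = (D.wordProd a)⁻¹ := by
      simp only [wordProd, List.prod_inv_reverse, List.map_map, List.map_reverse]
      congr 2
    rw [this, ha]
    rfl

/-- The length of an element of `W`. -/
def len (w : D.W) : ℕ := sInf {n | ∃ ω : List (Fin r), D.wordProd ω = w ∧ ω.length = n}

/-- `ω` is a reduced decomposition of `w`. -/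
def IsReducedWord (ω : List (Fin r)) (w : D.W) : Prop :=
  D.wordProd ω = w ∧ ω.length = D.len w

/-- The Bruhat order: generated by `u < u t` for `t` a conjugate of a simple reflection with
`len u < len (u t)`. -/
def BruhatLE : D.W → D.W → Prop :=
  Relation.ReflTransGen fun u v =>
    (∃ (g : D.W) (i : Fin r), v = u * (g * D.s i * g⁻¹)) ∧ D.len u < D.len v

/-! ### The monoid `W̲` (0-Hecke monoid) -/

/-- The defining relations of `W̲`: `s̲ᵢ² = s̲ᵢ`, and the braid relations of `W`. If `sᵢ sⱼ` has
infinite order then `orderOf (sᵢ sⱼ) = 0`, and the second relation is `1 = 1`. -/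
inductive HeckeRel : FreeMonoid (Fin r) → FreeMonoid (Fin r) → Prop
  | idem (i : Fin r) : HeckeRel (FreeMonoid.of i * FreeMonoid.of i) (FreeMonoid.of i)
  | braid (i j : Fin r) : HeckeRel
      (FreeMonoid.ofList (CoxeterSystem.alternatingWord i j (orderOf (D.s i * D.s j))))
      (FreeMonoid.ofList (CoxeterSystem.alternatingWord j i (orderOf (D.s i * D.s j))))

/-- The monoid `W̲`. -/
abbrev HeckeMonoid : Type := PresentedMonoid D.HeckeRel

/-- The product `s̲_{i₁} ⋯ s̲_{iₗ}` in `W̲` of a word `[i₁, …, iₗ]`. -/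
def heckeProd (ω : List (Fin r)) : D.HeckeMonoid :=
  (ω.map fun i => PresentedMonoid.of D.HeckeRel i).prod

/-- `x = w̲`, that is, `x = s̲_{i₁} ⋯ s̲_{iₗ}` for a reduced decomposition `w = s_{i₁} ⋯ s_{iₗ}`. -/
def IsUnderline (w : D.W) (x : D.HeckeMonoid) : Prop :=
  ∃ ω, D.IsReducedWord ω w ∧ D.heckeProd ω = x

/-! ### Integral weights, `R[T]`, `Q[T]` -/

/-- The group `𝔥_ℤ* = Hom(𝔥_ℤ, ℤ) ⊂ 𝔥*` of integral weights, i.e. the character group of `T`. -/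
def P : AddSubgroup (Dual ℂ 𝔥) where
  carrier := {μ | ∀ x ∈ D.lattice, ∃ n : ℤ, μ x = n}
  zero_mem' := fun _ _ => ⟨0, by simp⟩
  add_mem' := fun {a b} ha hb x hx => by
    obtain ⟨m, hm⟩ := ha x hx
    obtain ⟨n, hn⟩ := hb x hx
    exact ⟨m + n, by simp [hm, hn]⟩
  neg_mem' := fun {a} ha x hx => by
    obtain ⟨m, hm⟩ := ha x hx
    exact ⟨-m, by simp [hm]⟩

theorem refl_mem (i : Fin r) {μ : Dual ℂ 𝔥} (hμ : μ ∈ D.P) : D.refl i μ ∈ D.P := by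
  intro x hx
  obtain ⟨a, ha⟩ := hμ x hx
  obtain ⟨b, hb⟩ := hμ _ (D.h_mem i)
  obtain ⟨c, hc⟩ := D.α_integral i x hx
  exact ⟨a - b * c, by simp [refl_apply, ha, hb, hc]⟩

theorem weyl_mem (w : D.W) {μ : Dual ℂ 𝔥} (hμ : μ ∈ D.P) : w.1 μ ∈ D.P := by
  obtain ⟨ω, rfl⟩ := D.exists_wordProd w
  induction ω with
  | nil => exact hμ
  | cons i ω ih => exact D.refl_mem i ih

/-- The action of `W` on integral weights. -/
def act (w : D.W) (μ : D.P) : D.P := ⟨w.1 μ.1, D.weyl_mem w μ.2⟩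

/-- The simple roots as integral weights. -/
def simpleRoot (i : Fin r) : D.P := ⟨D.α i, D.α_integral i⟩

/-- `ρ`, the sum of the fundamental weights. -/
def rho : D.P := ∑ i, ⟨D.fund i, D.fund_integral i⟩

/-- The representation ring `R[T]`, i.e. the group ring of the character group of `T`. -/
abbrev RT : Type _ := AddMonoidAlgebra ℤ D.P

/-- The character `e^μ`. -/
def e (μ : D.P) : D.RT := AddMonoidAlgebra.single μ 1

instance : TwoUniqueSums D.P :=
  letI : Module ℚ (Dual ℂ 𝔥) := Module.compHom _ (algebraMap ℚ ℂ)
  TwoUniqueSums.of_injective_addHom (D.P.subtype : D.P →ₙ+ Dual ℂ 𝔥)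
    Subtype.val_injective inferInstance

instance : IsDomain D.RT := NoZeroDivisors.to_isDomain _

/-- The fraction field `Q[T]` of `R[T]`. -/
abbrev QT : Type _ := FractionRing D.RT

/-- The inclusion of `R[T]` in `Q[T]`. -/
def toQT : D.RT →+* D.QT := algebraMap D.RT D.QT

/-! ### Demazure operators and the functions `ψ^w` -/

/-- `(Dᵢ f)(v) = (f(v) - f(v sᵢ) e^{-v αᵢ}) / (1 - e^{-v αᵢ})`. -/
def demazure (i : Fin r) (f : D.W → D.QT) (v : D.W) : D.QT :=
  (f v - f (v * D.s i) * D.toQT (D.e (-D.act v (D.simpleRoot i)))) /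
    (1 - D.toQT (D.e (-D.act v (D.simpleRoot i))))

/-- `D_{i₁} (D_{i₂} (⋯ (D_{iₗ} f)))` for a word `[i₁, …, iₗ]`. The operator `D_w` is the operator
of any reduced decomposition of `w`. -/
def demazureWord (ω : List (Fin r)) (f : D.W → D.QT) : D.W → D.QT :=
  ω.foldr D.demazure f

/-- `Ψ`: the functions `f : W → R[T]` such that `D_w f` has values in `R[T]` for all `w ∈ W`. -/
def Psi : Set (D.W → D.RT) :=
  {f | ∀ (w : D.W) (ω : List (Fin r)), D.IsReducedWord ω w →
    ∀ v, D.demazureWord ω (fun u => D.toQT (f u)) v ∈ Set.range D.toQT}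

/-- The family `(ψ^w)` (where `ψ w v` stands for `ψ^w(v)`) consists of elements of `Ψ`, and
`D_u(ψ^w)(1) = δ_{u,w}` for all `u, w ∈ W`, whichever reduced decomposition of `u` is used to
compute `D_u`. -/
def IsKostantKumarFamily (ψ : D.W → D.W → D.RT) : Prop :=
  (∀ w, ψ w ∈ D.Psi) ∧
  ∀ (u w : D.W) (ω : List (Fin r)), D.IsReducedWord ω u →
    (u = w → D.demazureWord ω (fun v => D.toQT (ψ w v)) 1 = 1) ∧
    (u ≠ w → D.demazureWord ω (fun v => D.toQT (ψ w v)) 1 = 0)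

/-! ### Words and subwords -/

/-- `β_j = s_{i₁} ⋯ s_{i_{j-1}} α_{i_j}`. -/
def beta {l : ℕ} (i : Fin l → Fin r) (j : Fin l) : D.P :=
  D.act (D.wordProd ((List.ofFn i).take j)) (D.simpleRoot (i j))

/-- For `J = {j₁ < ⋯ < j_m}`, the product `s̲_{i_{j₁}} ⋯ s̲_{i_{j_m}}` is equal to `w̲`. -/
def SubwordIs {l : ℕ} (i : Fin l → Fin r) (J : Finset (Fin l)) (w : D.W) : Prop :=
  D.IsUnderline w (D.heckeProd (J.sort.map i))

open Classical in
/-- The sum, over `len w ≤ m ≤ l` and over the `j₁ < ⋯ < j_m` such that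
`s̲_{i_{j₁}} ⋯ s̲_{i_{j_m}} = w̲`, of `(e^{-β_{j₁}} - 1) ⋯ (e^{-β_{j_m}} - 1)`. -/
def subwordSum {l : ℕ} (i : Fin l → Fin r) (w : D.W) : D.RT :=
  ∑ m ∈ Finset.Icc (D.len w) l,
    ∑ J ∈ Finset.univ.filter fun J : Finset (Fin l) => J.card = m ∧ D.SubwordIs i J w,
      ∏ j ∈ J, (D.e (-D.beta i j) - 1)

end

end KacMoodyDatum

namespace KacMoodyDatum

noncomputable section

variable {r : ℕ} {A : Matrix (Fin r) (Fin r) ℤ} {𝔥 : Type*} [AddCommGroup 𝔥] [Module ℂ 𝔥]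
  (D : KacMoodyDatum A 𝔥)

open CoxeterSystem (alternatingWord alternatingWord_succ alternatingWord_succ'
  length_alternatingWord)

/-! ### The action of `W` on integral weights and the pairing with coroots -/

/-! Attach to a word `i₁ … iₗ` the ordered product of the factors 1 + (e^{-β_j} - 1) s̲_{i_j} in the
monoid algebra R[T][W̲]. As s̲_i is idempotent, 1 + (x - 1) s̲_i is multiplicative in x, so a
repeated letter contributes a factor and its inverse; in rank two these factors satisfy Yang–Baxter
equations. Hence the product depends only on v = s_{i₁} ⋯ s_{iₗ}, even for nonreduced words
(`ybProd_eq_yb`); call it `yb v`. Put ψ^w(v) = e^{ρ - vρ} · (coefficient of w̲ in `yb v`). Expanding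
the product along any word of v is the subword formula.

From `yb_mul_s`, D_i sends v ↦ e^{ρ - vρ} · (coefficient of w̲ in `yb v * z`) to the same function
with z replaced by s̲_i z (`demazure_coeff_yb_mul`). So D_u ψ^w has values in R[T], and its value at
1 is the coefficient of w̲ in u̲. This is δ_{u,w} because the w̲ are distinct: W̲ acts on weights
with w̲ ρ = w ρ, and ρ has trivial stabilizer in W. Uniqueness holds because (D_u f)(1) involves
f(u) with a nonzero coefficient and otherwise only values of f at elements of smaller length.

The Coxeter-theoretic input (orders of the s_i s_j, Matsumoto's theorem, the trivial stabilizer)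
comes from one fact, `corootPairing_inv_rho_pos`: if w s_i is not shorter than w, then (w⁻¹ρ)(h_i) >
0. It is reduced to rank two by coset factorization. -/

theorem act_add (w : D.W) (μ ν : D.P) : D.act w (μ + ν) = D.act w μ + D.act w ν :=
  Subtype.ext (map_add w.1 μ.1 ν.1)

theorem act_neg (w : D.W) (μ : D.P) : D.act w (-μ) = -D.act w μ :=
  Subtype.ext (map_neg w.1 μ.1)

theorem act_sub (w : D.W) (μ ν : D.P) : D.act w (μ - ν) = D.act w μ - D.act w ν :=
  Subtype.ext (map_sub w.1 μ.1 ν.1)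

theorem act_zsmul (w : D.W) (n : ℤ) (μ : D.P) : D.act w (n • μ) = n • D.act w μ :=
  Subtype.ext (map_zsmul w.1 n μ.1)

@[simp] theorem act_one (μ : D.P) : D.act 1 μ = μ := rfl

theorem act_mul (u w : D.W) (μ : D.P) : D.act (u * w) μ = D.act u (D.act w μ) := rfl

/-- The pairing `μ ↦ μ(hᵢ)` on integral weights. -/
def corootPairing (i : Fin r) : D.P →+ ℤ where
  toFun μ := (μ.2 _ (D.h_mem i)).choose
  map_zero' := by
    have h := ((0 : D.P).2 _ (D.h_mem i)).choose_spec
    simpa using h.symm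
  map_add' μ ν := by
    have h := ((μ + ν).2 _ (D.h_mem i)).choose_spec
    have h1 := (μ.2 _ (D.h_mem i)).choose_spec
    have h2 := (ν.2 _ (D.h_mem i)).choose_spec
    have h3 : (μ + ν).1 (D.h i) = μ.1 (D.h i) + ν.1 (D.h i) := rfl
    rw [h, h1, h2] at h3
    exact_mod_cast h3

theorem corootPairing_cast (i : Fin r) (μ : D.P) : (D.corootPairing i μ : ℂ) = μ.1 (D.h i) :=
  (μ.2 _ (D.h_mem i)).choose_spec.symm

theorem corootPairing_simpleRoot (i j : Fin r) : D.corootPairing i (D.simpleRoot j) = A i j := by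
  have h := D.corootPairing_cast i (D.simpleRoot j)
  rw [show (D.simpleRoot j).1 = D.α j from rfl, D.pairing] at h
  exact_mod_cast h

theorem corootPairing_rho (i : Fin r) : D.corootPairing i D.rho = 1 := by
  have h := D.corootPairing_cast i D.rho
  have h2 : D.rho.1 (D.h i) = 1 := by
    have : D.rho.1 = ∑ k, D.fund k := by
      simp [rho]
    rw [this, LinearMap.sum_apply]
    simp [D.fund_apply]
  rw [h2] at h
  exact_mod_cast h

theorem act_s (i : Fin r) (μ : D.P) :
    D.act (D.s i) μ = μ - D.corootPairing i μ • D.simpleRoot i := by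
  apply Subtype.ext
  change D.refl i μ.1 = μ.1 - D.corootPairing i μ • D.α i
  rw [refl_apply, ← corootPairing_cast, Int.cast_smul_eq_zsmul]

theorem corootPairing_act_s (i j : Fin r) (μ : D.P) :
    D.corootPairing i (D.act (D.s j) μ) =
      D.corootPairing i μ - D.corootPairing j μ * A i j := by
  rw [act_s, map_sub, map_zsmul, corootPairing_simpleRoot, smul_eq_mul]

theorem corootPairing_act_s_self (i : Fin r) (μ : D.P) :
    D.corootPairing i (D.act (D.s i) μ) = -D.corootPairing i μ := by
  rw [corootPairing_act_s, D.isGCM.diag]; ring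

theorem s_mul_self (i : Fin r) : D.s i * D.s i = 1 := by
  apply Subtype.ext
  ext1 μ
  exact Module.involutive_reflection (D.α_h_self i) μ

theorem s_inv (i : Fin r) : (D.s i)⁻¹ = D.s i := inv_eq_of_mul_eq_one_left (D.s_mul_self i)

@[simp] theorem mul_s_mul_s (w : D.W) (i : Fin r) : w * D.s i * D.s i = w := by
  rw [mul_assoc, s_mul_self, mul_one]

/-! ### Words and length -/

@[simp] theorem wordProd_nil : D.wordProd [] = 1 := rfl

@[simp] theorem wordProd_cons (i : Fin r) (ω : List (Fin r)) :
    D.wordProd (i :: ω) = D.s i * D.wordProd ω := by simp [wordProd]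

@[simp] theorem wordProd_append (ω ω' : List (Fin r)) :
    D.wordProd (ω ++ ω') = D.wordProd ω * D.wordProd ω' := by simp [wordProd]

theorem exists_isReducedWord (w : D.W) : ∃ ω, D.IsReducedWord ω w := by
  have : {n | ∃ ω : List (Fin r), D.wordProd ω = w ∧ ω.length = n}.Nonempty := by
    obtain ⟨ω, h⟩ := D.exists_wordProd w
    exact ⟨_, ω, h, rfl⟩
  exact Nat.sInf_mem this

theorem len_wordProd_le (ω : List (Fin r)) : D.len (D.wordProd ω) ≤ ω.length :=
  Nat.sInf_le ⟨ω, rfl, rfl⟩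

theorem len_mul_le (u v : D.W) : D.len (u * v) ≤ D.len u + D.len v := by
  obtain ⟨a, rfl, ha⟩ := D.exists_isReducedWord u
  obtain ⟨b, rfl, hb⟩ := D.exists_isReducedWord v
  rw [← ha, ← hb, ← wordProd_append, ← List.length_append]
  exact D.len_wordProd_le _

@[simp] theorem len_one : D.len 1 = 0 := Nat.le_zero.1 (D.len_wordProd_le [])

theorem len_s_le (i : Fin r) : D.len (D.s i) ≤ 1 := by
  simpa using D.len_wordProd_le [i]

theorem len_mul_s_le (w : D.W) (i : Fin r) : D.len (w * D.s i) ≤ D.len w + 1 :=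
  (D.len_mul_le _ _).trans (Nat.add_le_add_left (D.len_s_le i) _)

theorem len_le_len_mul_s (w : D.W) (i : Fin r) : D.len w ≤ D.len (w * D.s i) + 1 := by
  simpa using D.len_mul_s_le (w * D.s i) i

theorem exists_len_mul_s_lt {w : D.W} (h : w ≠ 1) : ∃ i, D.len (w * D.s i) < D.len w := by
  obtain ⟨ω, rfl, hω⟩ := D.exists_isReducedWord w
  rcases List.eq_nil_or_concat ω with rfl | ⟨ω', i, rfl⟩
  · simp at h
  · refine ⟨i, ?_⟩
    rw [← hω]
    have := D.len_wordProd_le ω'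
    simp at this ⊢
    omega

theorem IsReducedWord.of_append_left {ω ω' : List (Fin r)} {w : D.W}
    (h : D.IsReducedWord (ω ++ ω') w) : D.IsReducedWord ω (D.wordProd ω) := by
  refine ⟨rfl, le_antisymm ?_ (D.len_wordProd_le ω)⟩
  have h1 := h.2
  rw [← h.1, wordProd_append, List.length_append] at h1
  have h2 := D.len_mul_le (D.wordProd ω) (D.wordProd ω')
  have h3 := D.len_wordProd_le ω'
  omega

theorem IsReducedWord.of_append_right {ω ω' : List (Fin r)} {w : D.W}
    (h : D.IsReducedWord (ω ++ ω') w) : D.IsReducedWord ω' (D.wordProd ω') := by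
  refine ⟨rfl, le_antisymm ?_ (D.len_wordProd_le ω')⟩
  have h1 := h.2
  rw [← h.1, wordProd_append, List.length_append] at h1
  have h2 := D.len_mul_le (D.wordProd ω) (D.wordProd ω')
  have h3 := D.len_wordProd_le ω
  omega

theorem IsReducedWord.concat {ω : List (Fin r)} {w : D.W} (h : D.IsReducedWord ω w) {i : Fin r}
    (hi : D.len w < D.len (w * D.s i)) : D.IsReducedWord (ω ++ [i]) (w * D.s i) := by
  refine ⟨by simp [h.1], ?_⟩
  have := D.len_mul_s_le w i
  rw [List.length_append, h.2, List.length_singleton]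
  omega

theorem wordProd_reverse (ω : List (Fin r)) : D.wordProd ω.reverse = (D.wordProd ω)⁻¹ := by
  induction ω with
  | nil => simp
  | cons i ω ih => simp [ih, s_inv]

theorem len_inv (w : D.W) : D.len w⁻¹ = D.len w := by
  have key : ∀ w, D.len w⁻¹ ≤ D.len w := fun w => by
    obtain ⟨ω, rfl, hω⟩ := D.exists_isReducedWord w
    rw [← hω, ← wordProd_reverse, ← List.length_reverse]
    exact D.len_wordProd_le _
  exact le_antisymm (key w) (by simpa using key w⁻¹)

/-! ### Rank two -/

/-- `alternatingWord i j n` always ends in `j` and grows on the left, so shorter ones are suffixes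
of longer ones. -/
theorem exists_eq_append_alternatingWord (i j : Fin r) {m n : ℕ} (h : m ≤ n) :
    ∃ ω, alternatingWord i j n = ω ++ alternatingWord i j m := by
  induction n, h using Nat.le_induction with
  | base => exact ⟨[], rfl⟩
  | succ n _ ih =>
    obtain ⟨ω, h⟩ := ih
    exact ⟨_ :: ω, by rw [alternatingWord_succ', h, List.cons_append]⟩

/-- The recursion satisfied by the pairings of coroots with the translates of a weight by
alternating products of two simple reflections. -/
theorem alternating_recursion_pos {p q : ℤ} {m : ℕ}
    (hpq : (p = 0 ∧ q = 0 ∧ m = 2) ∨ (p = 1 ∧ q = 1 ∧ m = 3) ∨ (p = 1 ∧ q = 2 ∧ m = 4) ∨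
      (p = 2 ∧ q = 1 ∧ m = 4) ∨ (p = 1 ∧ q = 3 ∧ m = 6) ∨ (p = 3 ∧ q = 1 ∧ m = 6) ∨
      (0 < p ∧ 0 < q ∧ 4 ≤ p * q ∧ m = 0))
    {b c : ℕ → ℤ} (hb : 0 < b 0) (hc : 0 < c 0) (hb1 : b 1 = b 0 + p * c 0)
    (hc1 : c 1 = c 0 + q * b 0) (hb2 : ∀ n, b (n + 2) = p * c (n + 1) - b n)
    (hc2 : ∀ n, c (n + 2) = q * b (n + 1) - c n) (n : ℕ) (hn : m = 0 ∨ n < m) :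
    0 < b n ∧ 0 < c n := by
  by_cases hm : m = 0
  · obtain ⟨hp, hq, h4⟩ : 0 < p ∧ 0 < q ∧ 4 ≤ p * q := by omega
    -- The last two inequalities carry the induction: as p q ≥ 4, q b_n ≤ 2 c_{n+1} gives 2 b_n ≤ p
    -- c_{n+1}, which is p c_{n+1} ≤ 2 b_{n+2}; likewise with b and c exchanged.
    have key : ∀ n, 0 < b n ∧ 0 < c n ∧ p * c n ≤ 2 * b (n + 1) ∧ q * b n ≤ 2 * c (n + 1) := by
      intro n
      induction n with
      | zero =>
        rw [zero_add, hb1, hc1]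
        refine ⟨hb, hc, ?_, ?_⟩ <;> nlinarith
      | succ n ih =>
        obtain ⟨h1, h2, h3, h4'⟩ := ih
        have h5 : 4 * b n ≤ p * (q * b n) := by nlinarith
        have h6 : 4 * c n ≤ q * (p * c n) := by nlinarith
        refine ⟨by nlinarith, by nlinarith, ?_, ?_⟩
        · rw [hb2]; nlinarith
        · rw [hc2]; nlinarith
    exact ⟨(key n).1, (key n).2.1⟩
  · have hn : n < m := by omega
    have h2 := hb2 0
    have h3 := hb2 1
    have h4 := hb2 2
    have h5 := hb2 3
    have k2 := hc2 0
    have k3 := hc2 1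
    have k4 := hc2 2
    have k5 := hc2 3
    norm_num at h2 h3 h4 h5 k2 k3 k4 k5
    rcases hpq with ⟨rfl, rfl, rfl⟩ | ⟨rfl, rfl, rfl⟩ | ⟨rfl, rfl, rfl⟩ | ⟨rfl, rfl, rfl⟩ |
      ⟨rfl, rfl, rfl⟩ | ⟨rfl, rfl, rfl⟩ | ⟨_, _, _, rfl⟩
    all_goals first | omega | (interval_cases n <;> constructor <;> omega)

/-- The order that `sᵢ sⱼ` has for `aᵢⱼ = -p`, `aⱼᵢ = -q`; zero stands for infinite order. -/
def RankTwo (A : Matrix (Fin r) (Fin r) ℤ) (i j : Fin r) (m : ℕ) : Prop :=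
  (-A i j = 0 ∧ -A j i = 0 ∧ m = 2) ∨ (-A i j = 1 ∧ -A j i = 1 ∧ m = 3) ∨
  (-A i j = 1 ∧ -A j i = 2 ∧ m = 4) ∨ (-A i j = 2 ∧ -A j i = 1 ∧ m = 4) ∨
  (-A i j = 1 ∧ -A j i = 3 ∧ m = 6) ∨ (-A i j = 3 ∧ -A j i = 1 ∧ m = 6) ∨
  (0 < -A i j ∧ 0 < -A j i ∧ 4 ≤ -A i j * -A j i ∧ m = 0)

theorem RankTwo.symm {i j : Fin r} {m : ℕ} (h : RankTwo A i j m) : RankTwo A j i m := by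
  unfold RankTwo at *
  rcases h with ⟨h1, h2, h3⟩ | ⟨h1, h2, h3⟩ | ⟨h1, h2, h3⟩ | ⟨h1, h2, h3⟩ | ⟨h1, h2, h3⟩ |
    ⟨h1, h2, h3⟩ | ⟨h1, h2, h4, h3⟩
  · exact .inl ⟨h2, h1, h3⟩
  · exact .inr (.inl ⟨h2, h1, h3⟩)
  · exact .inr (.inr (.inr (.inl ⟨h2, h1, h3⟩)))
  · exact .inr (.inr (.inl ⟨h2, h1, h3⟩))
  · exact .inr (.inr (.inr (.inr (.inr (.inl ⟨h2, h1, h3⟩)))))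
  · exact .inr (.inr (.inr (.inr (.inl ⟨h2, h1, h3⟩))))
  · exact .inr (.inr (.inr (.inr (.inr (.inr ⟨h2, h1, by rwa [mul_comm], h3⟩)))))

theorem exists_rankTwo (hA : IsGCM A) {i j : Fin r} (hij : i ≠ j) : ∃ m, RankTwo A i j m := by
  have h1 := hA.offDiag i j hij
  have h2 := hA.offDiag j i hij.symm
  have h3 := hA.zero_iff i j
  unfold RankTwo
  generalize A i j = a at *
  generalize A j i = b at *
  by_cases h0 : a = 0
  · exact ⟨2, by omega⟩
  · have hb : b ≠ 0 := fun h => h0 (h3.2 h)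
    by_cases h4 : 4 ≤ -a * -b
    · exact ⟨0, by omega⟩
    · have ha3 : -3 ≤ a := by nlinarith [show b ≤ -1 by omega, show a ≤ -1 by omega]
      have hb3 : -3 ≤ b := by nlinarith [show b ≤ -1 by omega, show a ≤ -1 by omega]
      have ha1 : a ≤ -1 := by omega
      have hb1 : b ≤ -1 := by omega
      interval_cases a <;> interval_cases b <;>
        first
        | (refine ⟨3, ?_⟩; norm_num; done)
        | (refine ⟨4, ?_⟩; norm_num; done)
        | (refine ⟨6, ?_⟩; norm_num; done)
        | (refine absurd ?_ h4; norm_num)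

variable {D} in
-- The rank-two case of the link between length and sign. Removing the last letter of the word,
-- which acts first on the coroot side, gives the recursion of `alternating_recursion_pos` with p =
-- -a_{ij}, q = -a_{ji}.
theorem corootPairing_alternating_pos {i j : Fin r} {m : ℕ} (h : RankTwo A i j m) {μ : D.P}
    (hi : 0 < D.corootPairing i μ) (hj : 0 < D.corootPairing j μ) (n : ℕ) (hn : m = 0 ∨ n < m) :
    0 < D.corootPairing i (D.act (D.wordProd (alternatingWord i j n))⁻¹ μ) := by
  have hsucc : ∀ (i j : Fin r) (n : ℕ),
      D.act (D.wordProd (alternatingWord i j (n + 1)))⁻¹ μ =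
        D.act (D.s j) (D.act (D.wordProd (alternatingWord j i n))⁻¹ μ) := by
    intro i j n
    rw [alternatingWord_succ, List.concat_eq_append, wordProd_append, mul_inv_rev, act_mul]
    simp [s_inv]
  refine (alternating_recursion_pos h
    (b := fun n => D.corootPairing i (D.act (D.wordProd (alternatingWord i j n))⁻¹ μ))
    (c := fun n => D.corootPairing j (D.act (D.wordProd (alternatingWord j i n))⁻¹ μ))
    ?_ ?_ ?_ ?_ ?_ ?_ n hn).1
  · simpa [alternatingWord] using hi
  · simpa [alternatingWord] using hj
  · simp only [hsucc, corootPairing_act_s _ i j]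
    simp [alternatingWord]; ring
  · simp only [hsucc, corootPairing_act_s _ j i]
    simp [alternatingWord]; ring
  · intro n
    simp only [hsucc i j (n + 1), corootPairing_act_s _ i j]
    simp only [hsucc j i n, corootPairing_act_s_self]
    ring
  · intro n
    simp only [hsucc j i (n + 1), corootPairing_act_s _ j i]
    simp only [hsucc i j n, corootPairing_act_s_self]
    ring

/-- Both reflections preserve μ + span(α_i, α_j), so a braid relation becomes an identity between
two coefficients. -/
theorem refl_left (i j : Fin r) (μ : Dual ℂ 𝔥) (x y : ℂ) :
    D.refl i (μ - x • D.α i - y • D.α j) =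
      μ - (μ (D.h i) - x - (A i j : ℂ) * y) • D.α i - y • D.α j := by
  rw [refl_apply]
  simp only [LinearMap.sub_apply, LinearMap.smul_apply, D.pairing, D.isGCM.diag, smul_eq_mul]
  push_cast
  module

theorem refl_right (i j : Fin r) (μ : Dual ℂ 𝔥) (x y : ℂ) :
    D.refl j (μ - x • D.α i - y • D.α j) =
      μ - x • D.α i - (μ (D.h j) - y - (A j i : ℂ) * x) • D.α j := by
  rw [sub_right_comm, refl_left, sub_right_comm]

variable {D} in
theorem wordProd_braid_of_rankTwo {i j : Fin r} {m : ℕ} (h : RankTwo A i j m) :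
    D.wordProd (alternatingWord i j m) = D.wordProd (alternatingWord j i m) := by
  have key : ∀ ω ω' : List (Fin r),
      (∀ μ : Dual ℂ 𝔥, ∀ x y : ℂ, ω.foldr (fun k ν => D.refl k ν) (μ - x • D.α i - y • D.α j) =
        ω'.foldr (fun k ν => D.refl k ν) (μ - x • D.α i - y • D.α j)) →
      D.wordProd ω = D.wordProd ω' := by
    intro ω ω' hω
    have hf : ∀ (ω : List (Fin r)) (μ : Dual ℂ 𝔥),
        (D.wordProd ω).1 μ = ω.foldr (fun k ν => D.refl k ν) μ := by
      intro ω μ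
      induction ω with
      | nil => rfl
      | cons k ω ih =>
        rw [List.foldr_cons, ← ih, wordProd_cons]; rfl
    apply Subtype.ext
    ext1 μ
    have := hω μ 0 0
    rw [zero_smul, zero_smul, sub_zero, sub_zero] at this
    rw [hf, hf, this]
  apply key
  intro μ x y
  have hcongr : ∀ {x x' y y' : ℂ}, x = x' → y = y' →
      μ - x • D.α i - y • D.α j = μ - x' • D.α i - y' • D.α j := by
    rintro _ _ _ _ rfl rfl; rfl
  unfold RankTwo at h
  rcases h with ⟨h1, h2, rfl⟩ | ⟨h1, h2, rfl⟩ | ⟨h1, h2, rfl⟩ | ⟨h1, h2, rfl⟩ |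
    ⟨h1, h2, rfl⟩ | ⟨h1, h2, rfl⟩ | ⟨h1, h2, _, rfl⟩
  case inr.inr.inr.inr.inr.inr => rfl
  all_goals
    rw [neg_eq_iff_eq_neg] at h1 h2
    simp only [alternatingWord, List.concat_eq_append, List.nil_append, List.cons_append,
      List.foldr_cons, List.foldr_nil, refl_left, refl_right, h1, h2]
    push_cast
    refine hcongr ?_ ?_ <;> ring

/-! ### Length and the sign of the pairings with `w⁻¹ ρ` -/

/-- Every `w ∈ W` factors, with additive lengths, into an element that is minimal in its coset
modulo `⟨sᵢ, sⱼ⟩` and an alternating word. -/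
theorem exists_coset_factorization {i j : Fin r} (w : D.W) :
    ∃ v a b n, ((a = i ∧ b = j) ∨ (a = j ∧ b = i)) ∧ w = v * D.wordProd (alternatingWord a b n) ∧
      D.len w = D.len v + n ∧ D.len v ≤ D.len (v * D.s i) ∧ D.len v ≤ D.len (v * D.s j) := by
  suffices key : ∀ (N : ℕ) (v : D.W) (a b : Fin r) (n : ℕ), D.len v = N →
      ((a = i ∧ b = j) ∨ (a = j ∧ b = i)) → w = v * D.wordProd (alternatingWord a b n) →
      D.len w = D.len v + n →
      ∃ v a b n, ((a = i ∧ b = j) ∨ (a = j ∧ b = i)) ∧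
        w = v * D.wordProd (alternatingWord a b n) ∧
        D.len w = D.len v + n ∧ D.len v ≤ D.len (v * D.s i) ∧ D.len v ≤ D.len (v * D.s j) from
    -- Start from v = w with the empty word, and move letters from v to the word while v still has a
    -- descent.
    key _ w i j 0 rfl (.inl ⟨rfl, rfl⟩) (by simp [alternatingWord]) rfl
  intro N
  induction N using Nat.strong_induction_on with
  | _ N ih =>
    intro v a b n hN hab hw hlen
    by_cases hv : D.len v ≤ D.len (v * D.s i) ∧ D.len v ≤ D.len (v * D.s j)
    · exact ⟨v, a, b, n, hab, hw, hlen, hv⟩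
    obtain ⟨c, hc, hcv⟩ : ∃ c, (c = a ∨ c = b) ∧ D.len (v * D.s c) < D.len v := by
      by_cases h1 : D.len v ≤ D.len (v * D.s i)
      · exact ⟨j, by grind, by by_contra! h; exact hv ⟨h1, h⟩⟩
      · exact ⟨i, by grind, by omega⟩
    have hlen' : D.len v = D.len (v * D.s c) + 1 := by
      have := D.len_le_len_mul_s v c
      omega
    cases n with
    | zero =>
      have hw' : w = v := by simpa [alternatingWord] using hw
      rcases hc with rfl | rfl
      · refine ih _ (by omega) (v * D.s c) b c 1 rfl (by tauto) ?_ (by omega)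
        simp [alternatingWord, hw']
      · refine ih _ (by omega) (v * D.s c) a c 1 rfl hab ?_ (by omega)
        simp [alternatingWord, hw']
    | succ k =>
      -- The right side is the first letter of the alternating word. If c equals it, the two cancel
      -- and w is too short; otherwise prepending c keeps the word alternating.
      by_cases hcf : c = if Even k then b else a
      · exfalso
        have h1 : w = v * D.s c * D.wordProd (alternatingWord a b k) := by
          rw [hw, alternatingWord_succ', ← hcf, wordProd_cons, mul_assoc]
        have h2 := D.len_mul_le (v * D.s c) (D.wordProd (alternatingWord a b k))
        have h3 := D.len_wordProd_le (alternatingWord a b k)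
        rw [length_alternatingWord] at h3
        rw [← h1] at h2
        omega
      · have hcf' : c = if Even (k + 1) then b else a := by
          simp only [Nat.even_add_one]
          split_ifs at hcf ⊢ <;> tauto
        refine ih _ (by omega) (v * D.s c) a b (k + 2) rfl hab ?_ (by omega)
        rw [alternatingWord_succ', ← hcf', wordProd_cons, ← mul_assoc, mul_s_mul_s, hw]

/-- Induction on length. Choose a descent j of w and factor w = v x with v minimal modulo ⟨s_i,
s_j⟩. By induction v⁻¹ρ is positive on h_i and h_j, and x is an alternating word that must end in j
and be shorter than the braid length m; the rank-two case then applies. -/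
theorem corootPairing_inv_rho_pos {w : D.W} {i : Fin r} (h : D.len w ≤ D.len (w * D.s i)) :
    0 < D.corootPairing i (D.act w⁻¹ D.rho) := by
  induction hN : D.len w using Nat.strong_induction_on generalizing w i with
  | _ N ih =>
    subst hN
    by_cases hw1 : w = 1
    · simp [hw1, corootPairing_rho]
    obtain ⟨j, hj⟩ := D.exists_len_mul_s_lt hw1
    have hij : i ≠ j := by rintro rfl; omega
    obtain ⟨v, a, b, n, hab, hw, hlen, hvi, hvj⟩ := D.exists_coset_factorization (i := i) (j := j) w
    have hn : n ≠ 0 := by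
      rintro rfl
      rw [show w = v by simpa [alternatingWord] using hw] at hj
      omega
    rcases hab with ⟨rfl, rfl⟩ | ⟨rfl, rfl⟩
    swap
    -- Here the alternating word ends in i, which would make w s_i shorter than w.
    · exfalso
      obtain ⟨k, rfl⟩ := Nat.exists_eq_succ_of_ne_zero hn
      have h1 : w * D.s b = v * D.wordProd (alternatingWord b a k) := by
        rw [hw, Nat.succ_eq_add_one, alternatingWord_succ]
        simp [← mul_assoc]
      have h2 := D.len_mul_le v (D.wordProd (alternatingWord b a k))
      have h3 := D.len_wordProd_le (alternatingWord b a k)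
      rw [length_alternatingWord] at h3
      rw [← h1] at h2
      omega
    obtain ⟨m, hm⟩ := exists_rankTwo D.isGCM hij
    by_cases hmn : m = 0 ∨ n < m
    · rw [hw, mul_inv_rev, act_mul]
      exact corootPairing_alternating_pos hm (ih _ (by omega) hvi rfl) (ih _ (by omega) hvj rfl)
        n hmn
    -- With n ≥ m, a braid move on the last m letters makes the word end in i, so again w s_i would
    -- be shorter.
    · exfalso
      obtain ⟨ω, hω⟩ := exists_eq_append_alternatingWord a b (show m ≤ n by omega)
      obtain ⟨k, rfl⟩ := Nat.exists_eq_succ_of_ne_zero (show m ≠ 0 by omega)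
      have hl := congrArg List.length hω
      simp only [List.length_append, length_alternatingWord] at hl
      have h1 : w * D.s a = v * D.wordProd (ω ++ alternatingWord a b k) := by
        rw [hw, hω, wordProd_append, wordProd_braid_of_rankTwo hm, Nat.succ_eq_add_one,
          alternatingWord_succ]
        simp [← mul_assoc]
      have h2 := D.len_mul_le v (D.wordProd (ω ++ alternatingWord a b k))
      have h3 := D.len_wordProd_le (ω ++ alternatingWord a b k)
      rw [List.length_append, length_alternatingWord] at h3
      rw [← h1] at h2
      omega

theorem corootPairing_mul_s_inv_rho (w : D.W) (i : Fin r) :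
    D.corootPairing i (D.act (w * D.s i)⁻¹ D.rho) = -D.corootPairing i (D.act w⁻¹ D.rho) := by
  rw [mul_inv_rev, act_mul, s_inv, corootPairing_act_s_self]

theorem corootPairing_inv_rho_neg {w : D.W} {i : Fin r} (h : D.len (w * D.s i) ≤ D.len w) :
    D.corootPairing i (D.act w⁻¹ D.rho) < 0 := by
  have := D.corootPairing_inv_rho_pos (w := w * D.s i) (i := i) (by simpa using h)
  rw [corootPairing_mul_s_inv_rho] at this
  omega

theorem len_mul_s_ne (w : D.W) (i : Fin r) : D.len (w * D.s i) ≠ D.len w := fun h => by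
  have h1 := D.corootPairing_inv_rho_pos h.ge
  have h2 := D.corootPairing_inv_rho_neg h.le
  omega

/-- A nontrivial element fixing ρ would have a descent i, forcing ρ(h_i) < 0, whereas ρ(h_i) = 1. -/
theorem act_rho_injective : Function.Injective fun w : D.W => D.act w D.rho := by
  intro u w huw
  by_contra hne
  have hx : w⁻¹ * u ≠ 1 := fun h => hne (inv_mul_eq_one.1 h).symm
  have hρ : D.act (w⁻¹ * u)⁻¹ D.rho = D.rho := by
    have h : D.act w D.rho = D.act u D.rho := huw.symm
    rw [mul_inv_rev, inv_inv, act_mul, h, ← act_mul, inv_mul_cancel, act_one]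
  obtain ⟨i, hi⟩ := D.exists_len_mul_s_lt hx
  have := D.corootPairing_inv_rho_neg hi.le
  rw [hρ, corootPairing_rho] at this
  omega

/-! ### The orders of the products `sᵢ sⱼ` -/

theorem wordProd_alternatingWord_two_mul (i j : Fin r) (k : ℕ) :
    D.wordProd (alternatingWord i j (2 * k)) = (D.s i * D.s j) ^ k := by
  induction k with
  | zero => rfl
  | succ k ih =>
    rw [Nat.mul_succ, alternatingWord_succ, alternatingWord_succ, List.concat_eq_append,
      List.concat_eq_append, wordProd_append, wordProd_append, ih, pow_succ]
    simp [mul_assoc]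

variable {D} in
-- Otherwise the alternating word with 2k - 1 letters ending in i would represent s_j, and the
-- pairing that `corootPairing_alternating_pos` makes positive would be (s_j ρ)(h_j) = -1.
theorem pow_ne_one_of_rankTwo {i j : Fin r} {m : ℕ} (h : RankTwo A i j m) {k : ℕ} (hk : 0 < k)
    (hkm : m = 0 ∨ 2 * k ≤ m) : (D.s i * D.s j) ^ k ≠ 1 := by
  intro h1
  obtain ⟨k, rfl⟩ := Nat.exists_eq_succ_of_ne_zero hk.ne'
  rw [← wordProd_alternatingWord_two_mul, show 2 * k.succ = 2 * k + 1 + 1 by omega,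
    alternatingWord_succ, List.concat_eq_append, wordProd_append] at h1
  have h2 := corootPairing_alternating_pos (D := D) h.symm (μ := D.rho)
    (by simp [corootPairing_rho]) (by simp [corootPairing_rho]) (2 * k + 1) (by omega)
  rw [inv_eq_of_mul_eq_one_right h1] at h2
  simp [corootPairing_act_s_self, corootPairing_rho] at h2

variable {D} in
theorem pow_eq_one_of_rankTwo {i j : Fin r} {m : ℕ} (h : RankTwo A i j m) :
    (D.s i * D.s j) ^ m = 1 := by
  have hb := wordProd_braid_of_rankTwo (D := D) h
  have hinv : (D.s i * D.s j)⁻¹ = D.s j * D.s i := by simp [s_inv]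
  -- For even m the braid relation says that (s_i s_j)^{m/2} equals its own inverse.
  have heven : ∀ t, m = 2 * t → (D.s i * D.s j) ^ m = 1 := by
    rintro t rfl
    rw [wordProd_alternatingWord_two_mul, wordProd_alternatingWord_two_mul] at hb
    rw [two_mul, pow_add]
    nth_rw 2 [hb]
    rw [← hinv, inv_pow, mul_inv_cancel]
  unfold RankTwo at h
  rcases h with ⟨_, _, h⟩ | ⟨_, _, h⟩ | ⟨_, _, h⟩ | ⟨_, _, h⟩ | ⟨_, _, h⟩ | ⟨_, _, h⟩ |
    ⟨_, _, _, h⟩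
  case inr.inl =>
    subst h
    simp only [alternatingWord, List.concat_eq_append, List.nil_append, List.cons_append,
      wordProd_cons, wordProd_nil, mul_one] at hb
    calc (D.s i * D.s j) ^ 3 = D.s i * (D.s j * (D.s i * D.s j)) * (D.s i * D.s j) := by
          simp only [pow_succ, pow_zero, one_mul, mul_assoc]
      _ = D.s i * D.s i * D.s j * (D.s i * D.s i) * D.s j := by
          rw [hb]; simp only [mul_assoc]
      _ = 1 := by simp [s_mul_self]
  all_goals exact heven (m / 2) (by omega)

variable {D} in
theorem orderOf_of_rankTwo {i j : Fin r} {m : ℕ} (h : RankTwo A i j m) :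
    orderOf (D.s i * D.s j) = m := by
  rcases Nat.eq_zero_or_pos m with rfl | hm
  · exact orderOf_eq_zero_iff'.2 fun k hk => pow_ne_one_of_rankTwo h hk (.inl rfl)
  · obtain ⟨c, hc⟩ := orderOf_dvd_of_pow_eq_one (pow_eq_one_of_rankTwo (D := D) h)
    have hk : 0 < orderOf (D.s i * D.s j) := by
      rcases Nat.eq_zero_or_pos (orderOf (D.s i * D.s j)) with h0 | h0
      · rw [h0] at hc; omega
      · exact h0
    rcases Nat.lt_or_ge c 2 with h2 | h2
    · interval_cases c <;> omega
    · exact absurd (pow_orderOf_eq_one _)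
        (pow_ne_one_of_rankTwo (D := D) h hk (.inr (by rw [mul_comm]; nlinarith)))

theorem rankTwo_orderOf {i j : Fin r} (hij : i ≠ j) :
    RankTwo A i j (orderOf (D.s i * D.s j)) := by
  obtain ⟨m, hm⟩ := exists_rankTwo D.isGCM hij
  rwa [orderOf_of_rankTwo hm]

/-! ### Matsumoto's theorem -/

/-- Matsumoto's theorem: an equivalence relation on words which is stable under appending letters
and contains the braid moves relates any two reduced words of the same element. -/
theorem reducedWord_induction {R : List (Fin r) → List (Fin r) → Prop} (hR : Equivalence R)
    (happ : ∀ ω ω' i, R ω ω' → R (ω ++ [i]) (ω' ++ [i]))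
    (hbraid : ∀ ω i j, i ≠ j → R (ω ++ alternatingWord i j (orderOf (D.s i * D.s j)))
      (ω ++ alternatingWord j i (orderOf (D.s i * D.s j))))
    {w : D.W} {ω ω' : List (Fin r)} (hω : D.IsReducedWord ω w) (hω' : D.IsReducedWord ω' w) :
    R ω ω' := by
  induction hN : D.len w using Nat.strong_induction_on generalizing w ω ω' with
  | _ N ih =>
    subst hN
    have step : ∀ {ω₁ ω₂ : List (Fin r)} {i : Fin r}, D.IsReducedWord (ω₁ ++ [i]) w →
        D.IsReducedWord (ω₂ ++ [i]) w → R (ω₁ ++ [i]) (ω₂ ++ [i]) := by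
      intro ω₁ ω₂ i h1 h2
      have h3 := h1.of_append_left
      have h4 := h2.of_append_left
      have hp : D.wordProd ω₂ = D.wordProd ω₁ := by
        have := h2.1.trans h1.1.symm
        simpa using this
      rw [hp] at h4
      refine happ _ _ _ (ih _ ?_ h3 h4 rfl)
      rw [← h1.2, ← h3.2, List.length_append, List.length_singleton]
      omega
    have desc : ∀ {ω₁ : List (Fin r)} {i : Fin r}, D.IsReducedWord (ω₁ ++ [i]) w →
        D.len (w * D.s i) < D.len w := by
      intro ω₁ i h
      have h1 : w * D.s i = D.wordProd ω₁ := by rw [← h.1]; simp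
      rw [h1, ← h.2, List.length_append, List.length_singleton]
      exact Nat.lt_succ_of_le (D.len_wordProd_le _)
    have hconcat : ∀ {ω₁ : List (Fin r)} {i : Fin r}, D.IsReducedWord (ω₁.concat i) w →
        D.IsReducedWord (ω₁ ++ [i]) w := by
      intro ω₁ i h; rwa [← List.concat_eq_append]
    have hll := hω.2.trans hω'.2.symm
    rcases List.eq_nil_or_concat ω with rfl | ⟨ω₁, i, rfl⟩
    · rw [List.eq_nil_of_length_eq_zero hll.symm]
      exact hR.refl _
    rcases List.eq_nil_or_concat ω' with rfl | ⟨ω₂, j, rfl⟩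
    · simp at hll
    by_cases hij : i = j
    · subst hij
      rw [List.concat_eq_append, List.concat_eq_append]
      exact step (hconcat hω) (hconcat hω')
    -- The last letters differ, so i and j are both descents of w. The goal is a pair of reduced
    -- words of w, one ending in i and one in j, that differ by a single braid move; induction joins
    -- each to the given word with the same last letter.
    obtain ⟨v, a, b, n, hab, hw, hlen, hvi, hvj⟩ := D.exists_coset_factorization (i := i) (j := j) w
    have habne : a ≠ b := by grind
    obtain ⟨hva, hvb, hda⟩ : D.len v ≤ D.len (v * D.s a) ∧ D.len v ≤ D.len (v * D.s b) ∧
        D.len (w * D.s a) < D.len w := by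
      rcases hab with ⟨rfl, rfl⟩ | ⟨rfl, rfl⟩
      · exact ⟨hvi, hvj, desc (hconcat hω)⟩
      · exact ⟨hvj, hvi, desc (hconcat hω')⟩
    have hm := D.rankTwo_orderOf habne
    set m := orderOf (D.s a * D.s b) with hmdef
    -- If n < m, positivity in rank two would contradict the descent at a.
    have hmn : ¬(m = 0 ∨ n < m) := by
      intro h
      have h1 := D.corootPairing_inv_rho_neg hda.le
      have h2 := corootPairing_alternating_pos hm (D.corootPairing_inv_rho_pos hva)
        (D.corootPairing_inv_rho_pos hvb) n h
      rw [← act_mul, ← mul_inv_rev, ← hw] at h2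
      omega
    obtain ⟨σ, hσ⟩ := exists_eq_append_alternatingWord a b (show m ≤ n by omega)
    obtain ⟨τ, hτ⟩ := D.exists_isReducedWord v
    have hl := congrArg List.length hσ
    simp only [List.length_append, length_alternatingWord] at hl
    have hredab : D.IsReducedWord (τ ++ σ ++ alternatingWord a b m) w := by
      refine ⟨?_, ?_⟩
      · rw [List.append_assoc, ← hσ, wordProd_append, hτ.1, hw]
      · rw [List.append_assoc, ← hσ, List.length_append, length_alternatingWord, hτ.2, hlen]
    have hredba : D.IsReducedWord (τ ++ σ ++ alternatingWord b a m) w := by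
      refine ⟨?_, ?_⟩
      · rw [← hredab.1, wordProd_append, ← wordProd_braid_of_rankTwo hm, ← wordProd_append]
      · rw [← hredab.2]; simp
    have hRab := hbraid (τ ++ σ) a b habne
    rw [← hmdef] at hRab
    obtain ⟨k, hk⟩ := Nat.exists_eq_succ_of_ne_zero (show m ≠ 0 by omega)
    rw [hk, Nat.succ_eq_add_one, alternatingWord_succ, List.concat_eq_append,
      ← List.append_assoc] at hredab hredba
    rw [hk, Nat.succ_eq_add_one, alternatingWord_succ, alternatingWord_succ,
      List.concat_eq_append, List.concat_eq_append, ← List.append_assoc,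
      ← List.append_assoc] at hRab
    rw [List.concat_eq_append, List.concat_eq_append]
    rcases hab with ⟨rfl, rfl⟩ | ⟨rfl, rfl⟩
    · exact hR.trans (step (hconcat hω) hredba) (hR.trans (hR.symm hRab)
        (step hredab (hconcat hω')))
    · exact hR.trans (step (hconcat hω) hredab) (hR.trans hRab (step hredba (hconcat hω')))

/-! ### The monoid `W̲` -/

/-- The generator `s̲ᵢ` of `W̲`. -/
def heckeGen (i : Fin r) : D.HeckeMonoid := PresentedMonoid.of D.HeckeRel i

@[simp] theorem heckeProd_nil : D.heckeProd [] = 1 := rfl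

@[simp] theorem heckeProd_cons (i : Fin r) (ω : List (Fin r)) :
    D.heckeProd (i :: ω) = D.heckeGen i * D.heckeProd ω := by simp [heckeProd, heckeGen]

@[simp] theorem heckeProd_append (ω ω' : List (Fin r)) :
    D.heckeProd (ω ++ ω') = D.heckeProd ω * D.heckeProd ω' := by simp [heckeProd]

theorem mk_ofList (ω : List (Fin r)) :
    PresentedMonoid.mk D.HeckeRel (FreeMonoid.ofList ω) = D.heckeProd ω := by
  induction ω with
  | nil => rfl
  | cons i ω ih =>
    rw [heckeProd_cons, ← ih, FreeMonoid.ofList_cons, map_mul]; rfl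

theorem heckeGen_mul_self (i : Fin r) : D.heckeGen i * D.heckeGen i = D.heckeGen i :=
  PresentedMonoid.mk_eq_mk_of_rel (HeckeRel.idem i)

theorem heckeProd_braid (i j : Fin r) :
    D.heckeProd (alternatingWord i j (orderOf (D.s i * D.s j))) =
      D.heckeProd (alternatingWord j i (orderOf (D.s i * D.s j))) := by
  rw [← mk_ofList, ← mk_ofList]
  exact PresentedMonoid.mk_eq_mk_of_rel (HeckeRel.braid i j)

theorem heckeProd_eq_of_isReducedWord {w : D.W} {ω ω' : List (Fin r)} (h : D.IsReducedWord ω w)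
    (h' : D.IsReducedWord ω' w) : D.heckeProd ω = D.heckeProd ω' := by
  refine D.reducedWord_induction (R := fun ω ω' => D.heckeProd ω = D.heckeProd ω')
    ⟨fun _ => rfl, Eq.symm, Eq.trans⟩ ?_ ?_ h h'
  · intro ω ω' i h
    simp [h]
  · intro ω i j _
    rw [heckeProd_append, heckeProd_append, heckeProd_braid]

/-- The element `w̲` of `W̲`. -/
def underline (w : D.W) : D.HeckeMonoid := D.heckeProd (D.exists_isReducedWord w).choose

theorem IsReducedWord.heckeProd_eq {w : D.W} {ω : List (Fin r)} (h : D.IsReducedWord ω w) :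
    D.heckeProd ω = D.underline w :=
  D.heckeProd_eq_of_isReducedWord h (D.exists_isReducedWord w).choose_spec

theorem isUnderline_iff {w : D.W} {x : D.HeckeMonoid} : D.IsUnderline w x ↔ x = D.underline w := by
  constructor
  · rintro ⟨ω, h, rfl⟩
    exact h.heckeProd_eq
  · rintro rfl
    exact ⟨_, (D.exists_isReducedWord w).choose_spec, rfl⟩

theorem underline_mul_heckeGen_of_lt {w : D.W} {i : Fin r} (h : D.len w < D.len (w * D.s i)) :
    D.underline w * D.heckeGen i = D.underline (w * D.s i) := by
  obtain ⟨ω, hω⟩ := D.exists_isReducedWord w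
  rw [← (hω.concat D h).heckeProd_eq, ← hω.heckeProd_eq]
  simp

theorem underline_mul_heckeGen_of_gt {w : D.W} {i : Fin r} (h : D.len (w * D.s i) < D.len w) :
    D.underline w * D.heckeGen i = D.underline w := by
  have h1 := D.underline_mul_heckeGen_of_lt (w := w * D.s i) (i := i) (by simpa using h)
  rw [mul_s_mul_s] at h1
  rw [← h1, mul_assoc, heckeGen_mul_self]

/-- Multiplying w̲ by s̲_i gives the underline of w s_i if that is longer, and w̲ itself otherwise,
so the length grows by at most one per letter. -/
theorem exists_heckeProd_eq_underline (ω : List (Fin r)) :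
    ∃ w, D.heckeProd ω = D.underline w ∧ D.len w ≤ ω.length := by
  induction ω using List.reverseRecOn with
  | nil => exact ⟨1, IsReducedWord.heckeProd_eq D ⟨rfl, by simp⟩, by simp⟩
  | append_singleton ω i ih =>
    obtain ⟨w, h1, h2⟩ := ih
    rw [heckeProd_append, h1, heckeProd_cons, heckeProd_nil, mul_one, List.length_append,
      List.length_singleton]
    rcases lt_or_gt_of_ne (D.len_mul_s_ne w i) with h | h
    · exact ⟨w, D.underline_mul_heckeGen_of_gt h, by omega⟩
    · exact ⟨_, D.underline_mul_heckeGen_of_lt h,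
        (D.len_mul_s_le w i).trans (Nat.add_le_add_right h2 1)⟩

/-! ### `W̲` acts on weights; the elements `w̲` are distinct -/

/-- The operator that replaces a weight `μ` by `sᵢ μ` if `μ(hᵢ) > 0`, and else fixes it. -/
def lower (i : Fin r) (μ : D.P) : D.P := μ - max (D.corootPairing i μ) 0 • D.simpleRoot i

theorem lower_of_pos {i : Fin r} {μ : D.P} (h : 0 < D.corootPairing i μ) :
    D.lower i μ = D.act (D.s i) μ := by
  rw [lower, max_eq_left h.le, act_s]

theorem lower_lower (i : Fin r) (μ : D.P) : D.lower i (D.lower i μ) = D.lower i μ := by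
  have : max (D.corootPairing i (D.lower i μ)) 0 = 0 := by
    rw [lower, map_sub, map_zsmul, corootPairing_simpleRoot, D.isGCM.diag, smul_eq_mul]
    omega
  conv_lhs => rw [lower, this, zero_smul, sub_zero]

theorem lower_left (i j : Fin r) (μ : D.P) (x y : ℤ) :
    D.lower i (μ - x • D.simpleRoot i - y • D.simpleRoot j) =
      μ - (x + max (D.corootPairing i μ - 2 * x - A i j * y) 0) • D.simpleRoot i -
        y • D.simpleRoot j := by
  rw [lower]
  simp only [map_sub, map_zsmul, corootPairing_simpleRoot, D.isGCM.diag, smul_eq_mul]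
  rw [mul_comm x 2, mul_comm y]
  module

theorem lower_right (i j : Fin r) (μ : D.P) (x y : ℤ) :
    D.lower j (μ - x • D.simpleRoot i - y • D.simpleRoot j) =
      μ - x • D.simpleRoot i -
        (y + max (D.corootPairing j μ - 2 * y - A j i * x) 0) • D.simpleRoot j := by
  rw [sub_right_comm, lower_left, sub_right_comm]

/-- The braid relation for `lower` in type B₂, written in coefficients. The linear forms p, q, p +
q, 2p + q are the positive coroots, and their signs decide every `max`. -/
theorem max_recursion_four (p q : ℤ) {a₁ a₂ b₁ b₂ c₁ c₂ d₁ d₂ : ℤ} :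
    b₁ = max q 0 → a₁ = max (p + b₁) 0 →
    b₂ = b₁ + max (q - 2 * b₁ + 2 * a₁) 0 → a₂ = a₁ + max (p - 2 * a₁ + b₂) 0 →
    c₁ = max p 0 → d₁ = max (q + 2 * c₁) 0 →
    c₂ = c₁ + max (p - 2 * c₁ + d₁) 0 → d₂ = d₁ + max (q - 2 * d₁ + 2 * c₂) 0 →
    a₂ = c₂ ∧ b₂ = d₂ := by
  rcases lt_or_ge p 0 with h1 | h1 <;> rcases lt_or_ge q 0 with h2 | h2 <;>
  rcases lt_or_ge (p + q) 0 with h3 | h3 <;> rcases lt_or_ge (2 * p + q) 0 with h4 | h4 <;>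
  first
  | (exfalso; omega)
  | (iterate 8
      intro h
      first | rw [max_eq_left (by omega)] at h | rw [max_eq_right (by omega)] at h
     omega)

/-- The same for G₂, with its six positive coroots. -/
theorem max_recursion_six (p q : ℤ) {a₁ a₂ a₃ b₁ b₂ b₃ c₁ c₂ c₃ d₁ d₂ d₃ : ℤ} :
    b₁ = max q 0 → a₁ = max (p + b₁) 0 →
    b₂ = b₁ + max (q - 2 * b₁ + 3 * a₁) 0 → a₂ = a₁ + max (p - 2 * a₁ + b₂) 0 →
    b₃ = b₂ + max (q - 2 * b₂ + 3 * a₂) 0 → a₃ = a₂ + max (p - 2 * a₂ + b₃) 0 →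
    c₁ = max p 0 → d₁ = max (q + 3 * c₁) 0 →
    c₂ = c₁ + max (p - 2 * c₁ + d₁) 0 → d₂ = d₁ + max (q - 2 * d₁ + 3 * c₂) 0 →
    c₃ = c₂ + max (p - 2 * c₂ + d₂) 0 → d₃ = d₂ + max (q - 2 * d₂ + 3 * c₃) 0 →
    a₃ = c₃ ∧ b₃ = d₃ := by
  rcases lt_or_ge p 0 with h1 | h1 <;> rcases lt_or_ge q 0 with h2 | h2 <;>
  rcases lt_or_ge (p + q) 0 with h3 | h3 <;> rcases lt_or_ge (2 * p + q) 0 with h4 | h4 <;>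
  rcases lt_or_ge (3 * p + q) 0 with h5 | h5 <;>
  rcases lt_or_ge (3 * p + 2 * q) 0 with h6 | h6 <;>
  first
  | (exfalso; omega)
  | (iterate 12
      intro h
      first | rw [max_eq_left (by omega)] at h | rw [max_eq_right (by omega)] at h
     omega)

/-- The word length is the braid length: 3, 4, 6 for n = 1, 2, 3. -/
theorem lower_braid_aux {i j : Fin r} (n : ℕ) (hn : n = 1 ∨ n = 2 ∨ n = 3) (h1 : -A i j = 1)
    (h2 : -A j i = n) (μ : D.P) :
    (alternatingWord i j (if n = 1 then 3 else 2 * n)).foldr D.lower μ =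
      (alternatingWord j i (if n = 1 then 3 else 2 * n)).foldr D.lower μ := by
  have hcongr : ∀ {x x' y y' : ℤ}, x = x' ∧ y = y' →
      μ - x • D.simpleRoot i - y • D.simpleRoot j =
        μ - x' • D.simpleRoot i - y' • D.simpleRoot j := by
    rintro _ _ _ _ ⟨rfl, rfl⟩; rfl
  have h0 : μ = μ - (0 : ℤ) • D.simpleRoot i - (0 : ℤ) • D.simpleRoot j := by simp
  rw [h0]
  rw [neg_eq_iff_eq_neg] at h1 h2
  rcases hn with rfl | rfl | rfl
  all_goals
    norm_num only [Nat.reduceMul, if_true, if_false]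
    simp only [alternatingWord, List.concat_eq_append, List.nil_append, List.cons_append,
      List.foldr_cons, List.foldr_nil, lower_left, lower_right, h1, h2]
    generalize D.corootPairing i μ = p
    generalize D.corootPairing j μ = q
    apply hcongr
  · constructor <;> omega
  · have h := max_recursion_four p q rfl rfl rfl rfl rfl rfl rfl rfl
    ring_nf at h ⊢
    exact h
  · have h := max_recursion_six p q rfl rfl rfl rfl rfl rfl rfl rfl rfl rfl rfl rfl
    ring_nf at h ⊢
    exact h

theorem lower_braid {i j : Fin r} {m : ℕ} (h : RankTwo A i j m) (μ : D.P) :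
    (alternatingWord i j m).foldr D.lower μ = (alternatingWord j i m).foldr D.lower μ := by
  unfold RankTwo at h
  rcases h with ⟨h1, h2, rfl⟩ | ⟨h1, h2, rfl⟩ | ⟨h1, h2, rfl⟩ | ⟨h1, h2, rfl⟩ |
    ⟨h1, h2, rfl⟩ | ⟨h1, h2, rfl⟩ | ⟨h1, h2, _, rfl⟩
  · rw [neg_eq_zero] at h1 h2
    simp only [alternatingWord, List.concat_eq_append, List.nil_append, List.cons_append,
      List.foldr_cons, List.foldr_nil]
    simp [lower, corootPairing_simpleRoot, h1, h2, sub_right_comm]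
  · exact D.lower_braid_aux 1 (by simp) h1 h2 μ
  · exact D.lower_braid_aux 2 (by simp) h1 h2 μ
  · exact (D.lower_braid_aux 2 (by simp) h2 h1 μ).symm
  · exact D.lower_braid_aux 3 (by simp) h1 h2 μ
  · exact (D.lower_braid_aux 3 (by simp) h2 h1 μ).symm
  · rfl

/-- The action of `W̲` on weights by the operators `lower`. -/
def lowerHom : D.HeckeMonoid →* Function.End D.P :=
  PresentedMonoid.lift (M := Function.End D.P) D.lower (by
    have hf : ∀ (ω : List (Fin r)) (μ : D.P),
        FreeMonoid.lift (M := Function.End D.P) D.lower (FreeMonoid.ofList ω) μ =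
          ω.foldr D.lower μ := by
      intro ω μ
      induction ω with
      | nil => rfl
      | cons i ω ih => rw [FreeMonoid.ofList_cons, map_mul, List.foldr_cons, ← ih]; rfl
    rintro _ _ (i | ⟨i, j⟩)
    · funext μ
      exact D.lower_lower i μ
    · by_cases hij : i = j
      · rw [hij]
      · funext μ
        rw [hf, hf, D.lower_braid (D.rankTwo_orderOf hij)])

theorem lowerHom_heckeGen_mul (i : Fin r) (x : D.HeckeMonoid) (μ : D.P) :
    D.lowerHom (D.heckeGen i * x) μ = D.lower i (D.lowerHom x μ) := by
  rw [map_mul]; rfl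

/-- Along a reduced word each letter s_i meets a weight u ρ with s_i u longer than u. Then (u
ρ)(h_i) > 0, so `lower` acts as the reflection. -/
theorem lowerHom_underline_rho (w : D.W) : D.lowerHom (D.underline w) D.rho = D.act w D.rho := by
  obtain ⟨ω, hω⟩ := D.exists_isReducedWord w
  rw [← hω.heckeProd_eq]
  induction ω generalizing w with
  | nil => rw [← hω.1]; simp; rfl
  | cons i ω ih =>
    have hω' := IsReducedWord.of_append_right D (ω := [i]) hω
    have hw : w = D.s i * D.wordProd ω := by rw [← hω.1, wordProd_cons]
    rw [heckeProd_cons, lowerHom_heckeGen_mul, ih _ hω', lower_of_pos, hw, act_mul]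
    have h1 : D.len (D.wordProd ω)⁻¹ ≤ D.len ((D.wordProd ω)⁻¹ * D.s i) := by
      rw [← D.s_inv i, ← mul_inv_rev, len_inv, len_inv, ← hw, ← hω.2, ← hω'.2]
      simp
    simpa using D.corootPairing_inv_rho_pos h1

theorem underline_injective : Function.Injective D.underline := fun u w h =>
  D.act_rho_injective (by
    change D.act u D.rho = D.act w D.rho
    rw [← lowerHom_underline_rho, ← lowerHom_underline_rho, h])

/-! ### Solutions of the Yang–Baxter equation from idempotents -/

section YangBaxter

variable {R S : Type*} [CommRing R] [Ring S] [Algebra R S]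

theorem one_add_smul_mul_eq_one {a : S} (ha : a * a = a) {x y : R} (h : x * y = 1) :
    (1 + (x - 1) • a) * (1 + (y - 1) • a) = 1 := by
  have h2 : (x - 1) + (y - 1) + (x - 1) * (y - 1) = 0 := by linear_combination h
  have h3 : (1 + (x - 1) • a) * (1 + (y - 1) • a) =
      1 + ((x - 1) + (y - 1) + (x - 1) * (y - 1)) • a := by
    simp only [mul_add, add_mul, mul_one, one_mul, smul_mul_assoc, mul_smul_comm, ha]
    module
  rw [h3, h2, zero_smul, add_zero]

theorem yangBaxter_two {a b : S} (h : a * b = b * a) (x y : R) :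
    (1 + (x - 1) • a) * (1 + (y - 1) • b) = (1 + (y - 1) • b) * (1 + (x - 1) • a) := by
  simp only [mul_add, add_mul, mul_one, one_mul, smul_mul_assoc, mul_smul_comm, smul_add, h]
  module

theorem yangBaxter_three {a b : S} (ha : a * a = a) (hb : b * b = b)
    (h : a * (b * a) = b * (a * b)) (x y : R) :
    (1 + (x - 1) • a) * ((1 + (x * y - 1) • b) * (1 + (y - 1) • a)) =
    (1 + (y - 1) • b) * ((1 + (x * y - 1) • a) * (1 + (x - 1) • b)) := by
  simp only [mul_add, add_mul, mul_one, one_mul, smul_mul_assoc, mul_smul_comm, smul_add,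
    ha, hb, h]
  module

/-- With x = e^{-α_i}, y = e^{-α_j}, the monomials are the positive roots of the rank-two system, in
the order in which the alternating word meets them; the other side reverses this order. Both sides
expand to the same combination of alternating products of a and b. -/
theorem yangBaxter_four {a b : S} (ha : a * a = a) (hb : b * b = b)
    (h : a * (b * (a * b)) = b * (a * (b * a))) (x y : R) :
    (1 + (x - 1) • a) * ((1 + (x ^ 2 * y - 1) • b) * ((1 + (x * y - 1) • a) *
      (1 + (y - 1) • b))) =
    (1 + (y - 1) • b) * ((1 + (x * y - 1) • a) * ((1 + (x ^ 2 * y - 1) • b) *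
      (1 + (x - 1) • a))) := by
  have ha' : ∀ z, a * (a * z) = a * z := fun z => by rw [← mul_assoc, ha]
  have hb' : ∀ z, b * (b * z) = b * z := fun z => by rw [← mul_assoc, hb]
  simp only [mul_add, add_mul, mul_one, one_mul, smul_mul_assoc, mul_smul_comm, smul_add,
    ha, hb, ha', hb', h]
  module

theorem yangBaxter_six {a b : S} (ha : a * a = a) (hb : b * b = b)
    (h : a * (b * (a * (b * (a * b)))) = b * (a * (b * (a * (b * a))))) (x y : R) :
    (1 + (x - 1) • a) * ((1 + (x ^ 3 * y - 1) • b) * ((1 + (x ^ 2 * y - 1) • a) *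
      ((1 + (x ^ 3 * y ^ 2 - 1) • b) * ((1 + (x * y - 1) • a) * (1 + (y - 1) • b))))) =
    (1 + (y - 1) • b) * ((1 + (x * y - 1) • a) * ((1 + (x ^ 3 * y ^ 2 - 1) • b) *
      ((1 + (x ^ 2 * y - 1) • a) * ((1 + (x ^ 3 * y - 1) • b) * (1 + (x - 1) • a))))) := by
  have ha' : ∀ z, a * (a * z) = a * z := fun z => by rw [← mul_assoc, ha]
  have hb' : ∀ z, b * (b * z) = b * z := fun z => by rw [← mul_assoc, hb]
  simp only [mul_add, add_mul, mul_one, one_mul, smul_mul_assoc, mul_smul_comm, smul_add,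
    ha, hb, ha', hb', h]
  module

end YangBaxter

/-! ### Characters -/

theorem e_add (μ ν : D.P) : D.e (μ + ν) = D.e μ * D.e ν := by
  simp [e, AddMonoidAlgebra.single_mul_single]

@[simp] theorem e_zero : D.e 0 = 1 := rfl

theorem e_mul_e_neg (μ : D.P) : D.e μ * D.e (-μ) = 1 := by
  rw [← e_add, add_neg_cancel, e_zero]

theorem e_injective : Function.Injective D.e :=
  AddMonoidAlgebra.single_left_injective one_ne_zero

theorem e_nsmul (n : ℕ) (μ : D.P) : D.e (n • μ) = D.e μ ^ n := by
  induction n with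
  | zero => simp
  | succ n ih => rw [succ_nsmul, e_add, ih, pow_succ]

theorem act_simpleRoot_ne_zero (v : D.W) (i : Fin r) : D.act v (D.simpleRoot i) ≠ 0 := by
  intro h
  have h1 : D.simpleRoot i = 0 := by
    have h2 := congrArg (D.act v⁻¹) h
    rw [← act_mul, inv_mul_cancel, act_one] at h2
    rw [h2]
    exact Subtype.ext (map_zero (v⁻¹ : D.W).1)
  have h3 := D.corootPairing_simpleRoot i i
  rw [h1, map_zero, D.isGCM.diag] at h3
  omega

theorem toQT_injective : Function.Injective D.toQT := IsFractionRing.injective D.RT D.QT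

theorem one_sub_toQT_e_ne_zero (v : D.W) (i : Fin r) :
    1 - D.toQT (D.e (-D.act v (D.simpleRoot i))) ≠ 0 := by
  intro h
  rw [sub_eq_zero, ← map_one D.toQT] at h
  have h1 := D.toQT_injective h
  rw [← e_zero] at h1
  exact D.act_simpleRoot_ne_zero v i (neg_eq_zero.1 (D.e_injective h1.symm))

/-! ### Products of Yang–Baxter factors in `R[T][W̲]` -/

/-- The monoid algebra of `W̲` over `R[T]`. -/
abbrev HeckeAlgebra : Type _ := MonoidAlgebra D.RT D.HeckeMonoid

/-- The element of the monoid algebra given by an element of `W̲`. -/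
def heckeOf : D.HeckeMonoid →* D.HeckeAlgebra := MonoidAlgebra.of D.RT D.HeckeMonoid

/-- `1 + (e^{-μ} - 1) s̲ᵢ`. -/
def ybFactor (i : Fin r) (μ : D.P) : D.HeckeAlgebra :=
  1 + (D.e (-μ) - 1) • D.heckeOf (D.heckeGen i)

/-- The product of the factors `1 + (e^{-vβ_j} - 1) s̲_{i_j}` for a word `[i₁, …, iₗ]`. -/
def ybProd : D.W → List (Fin r) → D.HeckeAlgebra
  | _, [] => 1
  | v, i :: ω => D.ybFactor i (D.act v (D.simpleRoot i)) * ybProd (v * D.s i) ω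

theorem heckeOf_heckeGen_mul_self (i : Fin r) :
    D.heckeOf (D.heckeGen i) * D.heckeOf (D.heckeGen i) = D.heckeOf (D.heckeGen i) := by
  rw [← map_mul, heckeGen_mul_self]

theorem ybFactor_mul_neg (i : Fin r) (μ : D.P) : D.ybFactor i μ * D.ybFactor i (-μ) = 1 := by
  refine one_add_smul_mul_eq_one (D.heckeOf_heckeGen_mul_self i) ?_
  rw [neg_neg, mul_comm, e_mul_e_neg]

theorem ybProd_append (v : D.W) (ω ω' : List (Fin r)) :
    D.ybProd v (ω ++ ω') = D.ybProd v ω * D.ybProd (v * D.wordProd ω) ω' := by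
  induction ω generalizing v with
  | nil => simp [ybProd]
  | cons i ω ih => simp [ybProd, ih, mul_assoc]

theorem act_mul_s_left (v : D.W) (i j : Fin r) (x y : ℤ) :
    D.act (v * D.s i) (x • D.simpleRoot i + y • D.simpleRoot j) =
      D.act v ((-x - A i j * y) • D.simpleRoot i + y • D.simpleRoot j) := by
  rw [act_mul, act_s]
  simp only [map_add, map_zsmul, corootPairing_simpleRoot, D.isGCM.diag, smul_eq_mul]
  congr 1
  rw [mul_comm x, mul_comm y]
  module

theorem act_mul_s_right (v : D.W) (i j : Fin r) (x y : ℤ) :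
    D.act (v * D.s j) (x • D.simpleRoot i + y • D.simpleRoot j) =
      D.act v (x • D.simpleRoot i + (-y - A j i * x) • D.simpleRoot j) := by
  rw [add_comm, act_mul_s_left, add_comm]

theorem e_neg_act_add (v : D.W) (i j : Fin r) (x y : ℕ) :
    D.e (-D.act v ((x : ℤ) • D.simpleRoot i + (y : ℤ) • D.simpleRoot j)) =
      D.e (-D.act v (D.simpleRoot i)) ^ x * D.e (-D.act v (D.simpleRoot j)) ^ y := by
  rw [act_add, act_zsmul, act_zsmul, neg_add, e_add, ← e_nsmul, ← e_nsmul]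
  simp

/-- Only one orientation of each non-simply-laced type is treated; exchanging i and j gives the
other. -/
theorem ybProd_braid_aux (i j : Fin r) (v : D.W) {n : ℕ}
    (h : (-A i j = 0 ∧ -A j i = 0 ∧ n = 2) ∨ (-A i j = 1 ∧ -A j i = 1 ∧ n = 3) ∨
      (-A i j = 2 ∧ -A j i = 1 ∧ n = 4) ∨ (-A i j = 3 ∧ -A j i = 1 ∧ n = 6))
    (hbr : D.heckeProd (alternatingWord i j n) = D.heckeProd (alternatingWord j i n)) :
    D.ybProd v (alternatingWord i j n) = D.ybProd v (alternatingWord j i n) := by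
  have hi : ∀ u, D.ybFactor i (D.act u (D.simpleRoot i)) =
      1 + (D.e (-D.act u ((1 : ℤ) • D.simpleRoot i + (0 : ℤ) • D.simpleRoot j)) - 1) •
        D.heckeOf (D.heckeGen i) := fun u => by simp [ybFactor]
  have hj : ∀ u, D.ybFactor j (D.act u (D.simpleRoot j)) =
      1 + (D.e (-D.act u ((0 : ℤ) • D.simpleRoot i + (1 : ℤ) • D.simpleRoot j)) - 1) •
        D.heckeOf (D.heckeGen j) := fun u => by simp [ybFactor]
  have ha := D.heckeOf_heckeGen_mul_self i
  have hb := D.heckeOf_heckeGen_mul_self j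
  have he := D.e_neg_act_add v i j
  have e10 := he 1 0
  have e01 := he 0 1
  have e11 := he 1 1
  have e21 := he 2 1
  have e31 := he 3 1
  have e32 := he 3 2
  simp only [Nat.cast_ofNat, Nat.cast_one, Nat.cast_zero, pow_one, pow_zero, one_mul, mul_one]
    at e10 e01 e11 e21 e31 e32
  replace hbr := congrArg D.heckeOf hbr
  rcases h with ⟨h1, h2, rfl⟩ | ⟨h1, h2, rfl⟩ | ⟨h1, h2, rfl⟩ | ⟨h1, h2, rfl⟩
  all_goals
    rw [neg_eq_iff_eq_neg] at h1 h2
    simp only [alternatingWord, List.concat_eq_append, List.nil_append, List.cons_append,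
      heckeProd_cons, heckeProd_nil, mul_one, map_mul] at hbr
    simp only [alternatingWord, List.concat_eq_append, List.nil_append, List.cons_append,
      ybProd, mul_one, hi, hj, act_mul_s_left, act_mul_s_right, h1, h2]
    simp only [Int.reduceNeg, Int.reduceSub, Int.reduceMul, neg_zero]
    simp only [e10, e01, e11, e21, e31, e32]
  · exact yangBaxter_two hbr _ _
  · exact (yangBaxter_three ha hb hbr.symm _ _).symm
  · exact yangBaxter_four ha hb hbr _ _
  · exact yangBaxter_six ha hb hbr _ _

theorem ybProd_braid {i j : Fin r} (hij : i ≠ j) (v : D.W) :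
    D.ybProd v (alternatingWord i j (orderOf (D.s i * D.s j))) =
      D.ybProd v (alternatingWord j i (orderOf (D.s i * D.s j))) := by
  have hbr := D.heckeProd_braid i j
  have h := D.rankTwo_orderOf hij
  generalize orderOf (D.s i * D.s j) = m at *
  unfold RankTwo at h
  rcases h with h | h | ⟨h1, h2, h3⟩ | h | ⟨h1, h2, h3⟩ | h | ⟨_, _, _, rfl⟩
  · exact D.ybProd_braid_aux i j v (.inl h) hbr
  · exact D.ybProd_braid_aux i j v (.inr (.inl h)) hbr
  · exact (D.ybProd_braid_aux j i v (.inr (.inr (.inl ⟨h2, h1, h3⟩))) hbr.symm).symm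
  · exact D.ybProd_braid_aux i j v (.inr (.inr (.inl h))) hbr
  · exact (D.ybProd_braid_aux j i v (.inr (.inr (.inr ⟨h2, h1, h3⟩))) hbr.symm).symm
  · exact D.ybProd_braid_aux i j v (.inr (.inr (.inr h))) hbr
  · rfl

theorem ybProd_eq_of_isReducedWord {w : D.W} {ω ω' : List (Fin r)} (h : D.IsReducedWord ω w)
    (h' : D.IsReducedWord ω' w) : D.ybProd 1 ω = D.ybProd 1 ω' := by
  refine (D.reducedWord_induction
    -- The relation also records the product in W, because an appended factor depends on it through
    -- its root.
    (R := fun ω ω' => D.ybProd 1 ω = D.ybProd 1 ω' ∧ D.wordProd ω = D.wordProd ω')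
    ⟨fun _ => ⟨rfl, rfl⟩, fun h => ⟨h.1.symm, h.2.symm⟩,
      fun h h' => ⟨h.1.trans h'.1, h.2.trans h'.2⟩⟩ ?_ ?_ h h').1
  · rintro ω ω' i ⟨h1, h2⟩
    simp [ybProd_append, h1, h2]
  · intro ω i j hij
    rw [ybProd_append, ybProd_append, ybProd_braid _ hij, wordProd_append, wordProd_append,
      wordProd_braid_of_rankTwo (D.rankTwo_orderOf hij)]
    exact ⟨rfl, rfl⟩

/-- The value of `ybProd 1` on the reduced words of `w`. -/
def yb (w : D.W) : D.HeckeAlgebra := D.ybProd 1 (D.exists_isReducedWord w).choose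

theorem IsReducedWord.ybProd_eq {w : D.W} {ω : List (Fin r)} (h : D.IsReducedWord ω w) :
    D.ybProd 1 ω = D.yb w :=
  D.ybProd_eq_of_isReducedWord h (D.exists_isReducedWord w).choose_spec

theorem yb_one : D.yb 1 = 1 := by
  have h : D.IsReducedWord [] 1 := ⟨rfl, by simp⟩
  rw [← h.ybProd_eq, ybProd]

/-- When w s_i is shorter, the formula is obtained by inverting the one at w s_i, as the root
changes sign there and `ybFactor_mul_neg` applies. Covering both cases is what admits nonreduced
words. -/
theorem yb_mul_s (w : D.W) (i : Fin r) :
    D.yb (w * D.s i) = D.yb w * D.ybFactor i (D.act w (D.simpleRoot i)) := by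
  have key : ∀ w : D.W, D.len w < D.len (w * D.s i) →
      D.yb (w * D.s i) = D.yb w * D.ybFactor i (D.act w (D.simpleRoot i)) := by
    intro w h
    obtain ⟨ω, hω⟩ := D.exists_isReducedWord w
    rw [← (hω.concat D h).ybProd_eq, ← hω.ybProd_eq, ybProd_append, hω.1, one_mul]
    simp [ybProd]
  rcases lt_or_gt_of_ne (D.len_mul_s_ne w i) with h | h
  · have h1 := key (w * D.s i) (by simpa using h)
    rw [mul_s_mul_s] at h1
    have h2 : D.act (w * D.s i) (D.simpleRoot i) = -D.act w (D.simpleRoot i) := by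
      rw [act_mul, act_s, corootPairing_simpleRoot, D.isGCM.diag, ← act_neg]
      congr 1
      module
    rw [h2] at h1
    have h3 := D.ybFactor_mul_neg i (-D.act w (D.simpleRoot i))
    rw [neg_neg] at h3
    rw [h1, mul_assoc, h3, mul_one]
  · exact key w h

theorem ybProd_eq_yb (ω : List (Fin r)) : D.ybProd 1 ω = D.yb (D.wordProd ω) := by
  induction ω using List.reverseRecOn with
  | nil => rw [wordProd_nil, yb_one, ybProd]
  | append_singleton ω i ih =>
    rw [ybProd_append, ih, wordProd_append, one_mul, wordProd_cons, wordProd_nil, mul_one, yb_mul_s]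
    simp [ybProd]

/-! ### The functions `ψ^w` -/

/-- The Kostant–Kumar functions `ψ^w`. -/
def psi (w v : D.W) : D.RT :=
  D.e (D.rho - D.act v D.rho) * (D.yb v).coeff (D.underline w)

theorem rho_sub_act_mul_s_rho (v : D.W) (i : Fin r) :
    D.rho - D.act (v * D.s i) D.rho =
      (D.rho - D.act v D.rho) + D.act v (D.simpleRoot i) := by
  rw [act_mul, act_s, corootPairing_rho, one_smul, act_sub]
  abel

/-- Passing from v to v s_i multiplies the prefactor by e^{vα_i}, which cancels the e^{-vα_i} of
D_i. The numerator is then 1 - e^{-vα_i} times the right side, by `yb_mul_s`. The free factor z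
makes the statement iterable. -/
theorem demazure_coeff_yb_mul (w : D.W) (i : Fin r) (z : D.HeckeAlgebra) (v : D.W) :
    D.demazure i (fun u => D.toQT (D.e (D.rho - D.act u D.rho) *
        (D.yb u * z).coeff (D.underline w))) v =
      D.toQT (D.e (D.rho - D.act v D.rho) *
        (D.yb v * (D.heckeOf (D.heckeGen i) * z)).coeff (D.underline w)) := by
  have hmul : D.yb (v * D.s i) * z = D.yb v * z +
      (D.e (-D.act v (D.simpleRoot i)) - 1) • (D.yb v * (D.heckeOf (D.heckeGen i) * z)) := by
    rw [yb_mul_s, ybFactor]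
    simp only [mul_add, add_mul, mul_one, smul_mul_assoc, mul_smul_comm, mul_assoc]
  rw [demazure, div_eq_iff (D.one_sub_toQT_e_ne_zero v i), ← map_one D.toQT, ← map_mul, ← map_sub,
    ← map_sub, ← map_mul]
  congr 1
  rw [hmul, rho_sub_act_mul_s_rho, e_add, MonoidAlgebra.coeff_add, MonoidAlgebra.coeff_smul,
    Finsupp.add_apply, Finsupp.smul_apply, smul_eq_mul]
  have h := D.e_mul_e_neg (D.act v (D.simpleRoot i))
  generalize (D.yb v * z).coeff (D.underline w) = c
  generalize (D.yb v * (D.heckeOf (D.heckeGen i) * z)).coeff (D.underline w) = c'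
  generalize D.e (D.act v (D.simpleRoot i)) = x at *
  generalize D.e (-D.act v (D.simpleRoot i)) = y at *
  generalize D.e (D.rho - D.act v D.rho) = t
  linear_combination (-t * (c + (y - 1) * c')) * h

theorem demazureWord_psi (w : D.W) (ω : List (Fin r)) :
    D.demazureWord ω (fun v => D.toQT (D.psi w v)) =
      fun v => D.toQT (D.e (D.rho - D.act v D.rho) *
        (D.yb v * D.heckeOf (D.heckeProd ω)).coeff (D.underline w)) := by
  induction ω with
  | nil => simp [demazureWord, psi]
  | cons i ω ih =>
    funext v
    rw [heckeProd_cons, map_mul D.heckeOf, ← demazure_coeff_yb_mul, ← ih]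
    rfl

theorem isKostantKumarFamily_psi : D.IsKostantKumarFamily D.psi := by
  refine ⟨fun w u ω _ v => ?_, fun u w ω hω => ?_⟩
  · rw [demazureWord_psi]
    exact ⟨_, rfl⟩
  · have h1 : D.demazureWord ω (fun v => D.toQT (D.psi w v)) 1 =
        D.toQT ((D.heckeOf (D.underline u)).coeff (D.underline w)) := by
      simp only [demazureWord_psi, yb_one, act_one, sub_self, e_zero, one_mul, hω.heckeProd_eq]
    rw [h1, heckeOf, MonoidAlgebra.of_apply, MonoidAlgebra.coeff_single]
    constructor
    · rintro rfl
      rw [Finsupp.single_eq_same, map_one]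
    · intro h
      rw [Finsupp.single_eq_of_ne' (D.underline_injective.ne h), map_zero]

/-! ### Uniqueness -/

/-- The operators of words are triangular with respect to length. -/
theorem exists_demazureWord_sub_eq (ω : List (Fin r)) (f g : D.W → D.QT) (v : D.W)
    (hfg : ∀ ω' : List (Fin r), ω'.length < ω.length →
      f (v * D.wordProd ω') = g (v * D.wordProd ω')) :
    ∃ c : D.QT, c ≠ 0 ∧ D.demazureWord ω f v - D.demazureWord ω g v =
      c * (f (v * D.wordProd ω) - g (v * D.wordProd ω)) := by
  induction ω generalizing v with
  | nil => exact ⟨1, one_ne_zero, by simp [demazureWord]⟩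
  | cons i ω ih =>
    obtain ⟨c, -, h1⟩ := ih v fun ω' h => hfg ω' (h.trans (by simp))
    obtain ⟨c', hc', h2⟩ := ih (v * D.s i) fun ω' h => by
      simpa [mul_assoc] using hfg (i :: ω') (by simpa using h)
    -- The word ω is shorter than i :: ω, so f and g agree at v ω; only the term at v s_i survives.
    rw [hfg ω (by simp), sub_self, mul_zero] at h1
    have hne := D.one_sub_toQT_e_ne_zero v i
    have he : D.toQT (D.e (-D.act v (D.simpleRoot i))) ≠ 0 := by
      rw [Ne, map_eq_zero_iff _ D.toQT_injective]
      intro h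
      have := D.e_mul_e_neg (D.act v (D.simpleRoot i))
      rw [h, mul_zero] at this
      exact zero_ne_one this
    refine ⟨-(c' * D.toQT (D.e (-D.act v (D.simpleRoot i)))) /
      (1 - D.toQT (D.e (-D.act v (D.simpleRoot i)))), div_ne_zero
        (neg_ne_zero.2 (mul_ne_zero hc' he)) hne, ?_⟩
    change D.demazure i (D.demazureWord ω f) v - D.demazure i (D.demazureWord ω g) v = _
    rw [wordProd_cons, ← mul_assoc, demazure, demazure, ← sub_div, div_mul_eq_mul_div]
    congr 1
    linear_combination h1 - D.toQT (D.e (-D.act v (D.simpleRoot i))) * h2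

/-- Induction on the length of v: by triangularity, the condition on D_v at 1 determines the value
at v from those at shorter elements. -/
theorem IsKostantKumarFamily.unique {ψ ψ' : D.W → D.W → D.RT} (h : D.IsKostantKumarFamily ψ)
    (h' : D.IsKostantKumarFamily ψ') : ψ = ψ' := by
  funext w v
  induction hN : D.len v using Nat.strong_induction_on generalizing v with
  | _ N ih =>
    subst hN
    obtain ⟨ω, hω⟩ := D.exists_isReducedWord v
    obtain ⟨c, hc, hsub⟩ := D.exists_demazureWord_sub_eq ω (fun v => D.toQT (ψ w v))
      (fun v => D.toQT (ψ' w v)) 1 fun ω' hω' => by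
        rw [one_mul]
        exact congrArg D.toQT (ih _ (by
          rw [← hω.2]
          exact (D.len_wordProd_le ω').trans_lt hω') _ rfl)
    have heq : D.demazureWord ω (fun v => D.toQT (ψ w v)) 1 =
        D.demazureWord ω (fun v => D.toQT (ψ' w v)) 1 := by
      by_cases hvw : v = w
      · rw [(h.2 v w ω hω).1 hvw, (h'.2 v w ω hω).1 hvw]
      · rw [(h.2 v w ω hω).2 hvw, (h'.2 v w ω hω).2 hvw]
    rw [heq, sub_self, one_mul, hω.1] at hsub
    exact D.toQT_injective (sub_eq_zero.1 ((mul_eq_zero.1 hsub.symm).resolve_left hc))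

/-! ### The expansion over subwords -/

theorem sum_finset_fin_succ {M : Type*} [AddCommMonoid M] {l : ℕ}
    (F : Finset (Fin (l + 1)) → M) :
    ∑ J, F J = ∑ J : Finset (Fin l), F (J.map (Fin.succEmb l)) +
      ∑ J : Finset (Fin l), F (insert 0 (J.map (Fin.succEmb l))) := by
  have h : (Finset.univ.map (Fin.succEmb l)).powerset =
      Finset.univ.map (Finset.mapEmbedding (Fin.succEmb l)).toEmbedding := by
    ext J
    simp only [Finset.mem_powerset, Finset.subset_map_iff, Finset.mem_map, Finset.mem_univ,
      Finset.subset_univ, true_and]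
    exact exists_congr fun _ => eq_comm
  have h0 : (0 : Fin (l + 1)) ∉ Finset.univ.map (Fin.succEmb l) := by
    simp [Fin.succ_ne_zero]
  have hu : (Finset.univ : Finset (Fin (l + 1))) =
      insert 0 (Finset.univ.map (Fin.succEmb l)) := by
    rw [Fin.univ_succ, Finset.cons_eq_insert]
    rfl
  rw [← Finset.powerset_univ, hu, Finset.sum_powerset_insert h0, h, Finset.sum_map,
    Finset.sum_map]
  rfl

/-- The z_j need not commute, hence the sorted product. The induction splits the subsets by whether
they contain 0. -/
theorem prod_ofFn_one_add_smul {R S : Type*} [CommRing R] [Ring S] [Algebra R S] {l : ℕ}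
    (c : Fin l → R) (z : Fin l → S) :
    (List.ofFn fun j => 1 + c j • z j).prod =
      ∑ J : Finset (Fin l), (∏ j ∈ J, c j) • (J.sort.map z).prod := by
  induction l with
  | zero =>
    rw [List.ofFn_zero, List.prod_nil, Fintype.sum_eq_single ∅]
    · simp
    · intro J hJ
      exact absurd (Subsingleton.elim _ _) hJ
  | succ l ih =>
    have hmap : ∀ J : Finset (Fin l), (J.map (Fin.succEmb l)).sort = J.sort.map Fin.succ :=
      fun J => (StrictMonoOn.map_finsetSort (f := Fin.succEmb l) (s := J)
        (Fin.strictMono_succ.strictMonoOn _)).symm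
    have h0 : ∀ J : Finset (Fin l), (0 : Fin (l + 1)) ∉ J.map (Fin.succEmb l) := by
      intro J; simp [Fin.succ_ne_zero]
    rw [List.ofFn_succ, List.prod_cons, ih, add_mul, one_mul, smul_mul_assoc, Finset.mul_sum,
      Finset.smul_sum, sum_finset_fin_succ]
    congr 1
    · refine Finset.sum_congr rfl fun J _ => ?_
      rw [hmap, Finset.prod_map, List.map_map]
      rfl
    · refine Finset.sum_congr rfl fun J _ => ?_
      rw [Finset.sort_insert _ (fun _ _ => Fin.zero_le _) (h0 J), hmap, Finset.prod_insert (h0 J),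
        Finset.prod_map, List.map_cons, List.prod_cons, List.map_map, mul_smul_comm, smul_smul]
      rfl

theorem ybProd_ofFn (v : D.W) {l : ℕ} (i : Fin l → Fin r) :
    D.ybProd v (List.ofFn i) = (List.ofFn fun j => D.ybFactor (i j)
      (D.act (v * D.wordProd ((List.ofFn i).take j)) (D.simpleRoot (i j)))).prod := by
  induction l generalizing v with
  | zero => simp [ybProd]
  | succ l ih =>
    rw [List.ofFn_succ, ybProd, ih, List.ofFn_succ, List.prod_cons]
    simp [mul_assoc]

theorem yb_wordProd_ofFn {l : ℕ} (i : Fin l → Fin r) :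
    D.yb (D.wordProd (List.ofFn i)) = ∑ J : Finset (Fin l),
      (∏ j ∈ J, (D.e (-D.beta i j) - 1)) • D.heckeOf (D.heckeProd (J.sort.map i)) := by
  rw [← ybProd_eq_yb, ybProd_ofFn]
  simp only [one_mul, ybFactor]
  rw [prod_ofFn_one_add_smul]
  refine Finset.sum_congr rfl fun J _ => ?_
  congr 1
  rw [heckeProd, map_list_prod, List.map_map, List.map_map]
  rfl

open Classical in
theorem coeff_heckeOf_heckeProd {l : ℕ} (i : Fin l → Fin r) (J : Finset (Fin l)) (w : D.W) :
    (D.heckeOf (D.heckeProd (J.sort.map i))).coeff (D.underline w) =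
      if D.SubwordIs i J w then 1 else 0 := by
  rw [heckeOf, MonoidAlgebra.of_apply, MonoidAlgebra.coeff_single, Finsupp.single_apply]
  simp only [SubwordIs, isUnderline_iff]

/-- This makes the lower bound ℓ(w) ≤ m in the subword sum automatic. -/
theorem SubwordIs.len_le_card {l : ℕ} {i : Fin l → Fin r} {J : Finset (Fin l)} {w : D.W}
    (h : D.SubwordIs i J w) : D.len w ≤ J.card := by
  obtain ⟨u, h1, h2⟩ := D.exists_heckeProd_eq_underline (J.sort.map i)
  rw [SubwordIs, isUnderline_iff, h1] at h
  rw [← D.underline_injective h]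
  simpa using h2

theorem psi_wordProd_ofFn {l : ℕ} (i : Fin l → Fin r) (w : D.W) :
    D.psi w (D.wordProd (List.ofFn i)) =
      D.e (D.rho - D.act (D.wordProd (List.ofFn i)) D.rho) * D.subwordSum i w := by
  classical
  rw [psi, yb_wordProd_ofFn, MonoidAlgebra.coeff_sum, Finsupp.finsetSum_apply, subwordSum]
  congr 1
  simp only [MonoidAlgebra.coeff_smul, Finsupp.smul_apply, coeff_heckeOf_heckeProd, smul_eq_mul,
    mul_ite, mul_one, mul_zero]
  -- The sum over all subsets J is grouped by cardinality m.
  rw [← Finset.sum_filter, ← Finset.sum_fiberwise_of_maps_to (g := Finset.card)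
    (t := Finset.Icc (D.len w) l)]
  · refine Finset.sum_congr rfl fun m _ => ?_
    rw [Finset.filter_filter]
    refine Finset.sum_congr ?_ fun _ _ => rfl
    ext J
    simp [and_comm]
  · intro J hJ
    rw [Finset.mem_Icc]
    exact ⟨SubwordIs.len_le_card D (Finset.mem_filter.1 hJ).2, by simpa using J.card_le_univ⟩

end

end KacMoodyDatum

/-- The Kostant–Kumar functions `ψ^w : W → R[T]` exist and are unique, and their values are given by
the sum over subwords of an arbitrary (not necessarily reduced) word of `v`. -/
theorem mainTheorem2 {r : ℕ} {A : Matrix (Fin r) (Fin r) ℤ} {𝔥 : Type*} [AddCommGroup 𝔥]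
    [Module ℂ 𝔥] (D : KacMoodyDatum A 𝔥) :
    (∃! ψ : D.W → D.W → D.RT, D.IsKostantKumarFamily ψ) ∧
    ∀ ψ : D.W → D.W → D.RT, D.IsKostantKumarFamily ψ →
      ∀ w v : D.W, D.BruhatLE w v →
        ∀ (l : ℕ) (i : Fin l → Fin r), v = D.wordProd (List.ofFn i) →
          ψ w v = D.e (D.rho - D.act v D.rho) * D.subwordSum i w := by
  refine ⟨⟨D.psi, D.isKostantKumarFamily_psi, fun ψ h => h.unique D D.isKostantKumarFamily_psi⟩,
    fun ψ h w v _ l i hv => ?_⟩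
  rw [h.unique D D.isKostantKumarFamily_psi, hv, D.psi_wordProd_ofFn]
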